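/- Let $M\backslash R=(\mathcal S,\mathcal A,P_{sa},\gamma,D)$ be a finite MDP without reward function, $0\le\gamma<1$, with feature map $\phi:\mathcal S\to[0,1]^k$, $k\ge1$. For a (randomized, stationary) policy $\pi$ let $\Psi(\pi)=\mathbb E\big[\sum_{t\ge0}\gamma^t\phi(s_t)\,\big|\,\pi\big]$ and let $P_F=\{\Psi(\pi):\pi\text{ a policy}\}$. Assume that the features are normalized so that $\|\Psi(\pi)\|_1\le k$ for every policy $\pi$. The expected reward of $\pi$ under reward weights $w\in\mathbb R^k$, that is, under the reward function $R(s)=w\cdot\phi(s)$, is $w\cdot\Psi(\pi)$. Let $P_R\subseteq[-1,1]^k$ be a non-empty polytope of reward weights, accessed through a separation oracle $SO_R$, which on input $x\in\mathbb R^k$ answers "yes" if $x\in P_R$ and otherwise returns $(h,c)$ with $h\cdot y\le c$ for all $y\in P_R$ and $h\cdot x>c$. Let $\mathrm{ALG}$ be an MDP solver, which on reward weights $v$ returns a policy $\pi^*$ of maximal expected reward under $v$, together with $\mu^*=\Psi(\pi^*)$. The FPL algorithm with $T\ge1$ rounds sets $\delta=1/(k\sqrt T)$ and for $t=1,\dots,T$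 draws fresh independent perturbations $p_t,q_t$ uniformly from $[0,1/\delta]^k$, lets $(\pi_t,\mu_t)$ be the output of $\mathrm{ALG}$ on the reward weights $\sum_{i<t}w_i+p_t$, and lets $w_t\in\operatorname{argmin}_{w\in P_R}w\cdot\big(\sum_{i<t}\mu_i+q_t\big)$, computed by means of queries to $SO_R$. It outputs the randomized policy $\frac1T\sum_{t=1}^T\pi_t$, which picks $t\in\{1,\dots,T\}$ uniformly at random and then follows $\pi_t$. **Theorem.** (i) Let $\xi\in(0,1/2)$. The maxmin value $\max_{\mu\in P_F}\min_{w\in P_R}\mu\cdot w$ exists, and for every exact implementation of the minimization step, with probability at least $1-2\xi$ over $p_1,\dots,p_T,q_1,\dots,q_T$, the randomized policy that the FPL algorithm outputs has, under every $w\in P_R$, expected reward at least $$\max_{\mu\in P_F}\min_{w\in P_R}\mu\cdot w-\frac{k^2\left(6+4\sqrt{\ln(1/\xi)}\right)}{\sqrt T}.$$ (ii) Let $P_{sa}(s')$ and $\phi_j(s)$ be rational numbers, represented by at most $b$ and at most $\langle\phi\rangle$ bits respectively, and let $P_R$ be the solution set of a finite system of linear inequalities all of whose coefficients are rationals of at most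 $\beta$ bits. Then the minimization step has an exact implementation (one that depends only on $k$ and $\beta$, works for every such $P_R$ and every separation oracle for it, and returns an exact minimizer for every real objective vector) with which every iteration of the FPL algorithm makes exactly one query to $\mathrm{ALG}$ and $$O\!\left(k^2\left((\log k)^2+\big((b+\langle\phi\rangle)(|\mathcal A||\mathcal S|+k)+\beta+\log T\big)^2\right)\right)$$ queries to $SO_R$, with an absolute constant in the $O(\cdot)$. In particular, if $\beta=O\big((b+\langle\phi\rangle)(|\mathcal A||\mathcal S|+k)\big)$, the number of queries is $O\big(k^2\big((\log k)^2+((b+\langle\phi\rangle)(|\mathcal A||\mathcal S|+k)+\log T)^2\big)\big)$. -/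

import Mathlib

open MeasureTheory ProbabilityTheory

namespace MaxminRL

noncomputable section

/-- Vectors in `ℝ^k`: feature vectors and reward weights. -/
abbrev Vec (k : ℕ) : Type := Fin k → ℝ

/-! ### Markov decision processes without a reward function -/

/-- A stationary (possibly randomized) policy: a distribution over the actions at every state. -/
abbrev Policy (S A : Type*) [Fintype A] := S → stdSimplex ℝ A

/-- A finite discounted MDP without reward function, with a feature map into `[0,1]^k`. -/
structure RewardlessMDP (S A : Type*) [Fintype S] [Fintype A] (k : ℕ) where
  /-- `trans s a` is the distribution of the next state. -/
  trans : S → A → stdSimplex ℝ S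
  /-- The discount factor. -/
  discount : ℝ
  discount_nonneg : 0 ≤ discount
  discount_lt_one : discount < 1
  /-- The distribution of the initial state. -/
  init : stdSimplex ℝ S
  /-- The features of a state. -/
  feat : S → Vec k
  feat_mem : ∀ s j, feat s j ∈ Set.Icc (0 : ℝ) 1

variable {S A : Type*} [Fintype S] [Fintype A] {k : ℕ}

/-- `stateDist M π n s` is the probability that the state at time `n` is `s`, under policy `π`. -/
def stateDist (M : RewardlessMDP S A k) (π : Policy S A) : ℕ → S → ℝ
  | 0 => fun s => (M.init : S → ℝ) s
  | n + 1 => fun s' => ∑ s, ∑ a,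
      stateDist M π n s * (π s : A → ℝ) a * (M.trans s a : S → ℝ) s'

/-- `𝔼[∑ₙ γⁿ f(sₙ)]` for the trajectory `s₀, s₁, …` generated by policy `π`. -/
def discountedSum (M : RewardlessMDP S A k) (π : Policy S A) (f : S → ℝ) : ℝ :=
  ∑' n : ℕ, M.discount ^ n * ∑ s, stateDist M π n s * f s

/-- `Ψ(π) = 𝔼[∑ₙ γⁿ φ(sₙ)]`. -/
def featureExp (M : RewardlessMDP S A k) (π : Policy S A) : Vec k :=
  fun j => discountedSum M π (fun s => M.feat s j)

/-- The expected discounted reward of `π` under the reward function `R(s) = w ⬝ φ(s)`. -/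
def value (M : RewardlessMDP S A k) (π : Policy S A) (w : Vec k) : ℝ :=
  discountedSum M π (fun s => w ⬝ᵥ M.feat s)

/-- The expected discounted reward, under reward weights `w`, of the randomized policy
`(1/T) ∑ₜ πₜ`, which draws `t` uniformly from the `T` indices and then follows `πₜ`. -/
def uniformMixtureValue {T : ℕ} (M : RewardlessMDP S A k) (π : Fin T → Policy S A)
    (w : Vec k) : ℝ :=
  (1 / (T : ℝ)) * ∑ t, value M (π t) w

/-- `P_F`: the feature vectors of all policies. -/
def featurePolytope (M : RewardlessMDP S A k) : Set (Vec k) :=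
  Set.range (featureExp M)

/-- `v = max_{μ ∈ P_F} min_{w ∈ P_R} μ ⬝ w`, with the maximum and the minima attained. -/
def IsMaxminValue (PF PR : Set (Vec k)) (v : ℝ) : Prop :=
  IsGreatest {m : ℝ | ∃ μ ∈ PF, IsLeast ((fun w : Vec k => μ ⬝ᵥ w) '' PR) m} v

/-- `alg v` is the output, a policy and a feature vector, of an MDP solver on the MDP `M` with
reward function `v ⬝ φ(·)`: an optimal policy together with its feature vector. -/
def IsMDPSolver (M : RewardlessMDP S A k) (alg : Vec k → Policy S A × Vec k) : Prop :=
  ∀ v, (∀ π, value M π v ≤ value M (alg v).1 v) ∧ (alg v).2 = featureExp M (alg v).1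

/-! ### Polytopes, bit complexity and separation oracles -/

/-- An intersection of finitely many closed halfspaces. -/
def IsPolyhedron (P : Set (Vec k)) : Prop :=
  ∃ (m : ℕ) (a : Fin m → Vec k) (d : Fin m → ℝ), P = {w | ∀ i, a i ⬝ᵥ w ≤ d i}

/-- The number of bits that represent a rational: a sign, numerator and denominator. -/
def bitLength (q : ℚ) : ℕ := 1 + Nat.size q.num.natAbs + Nat.size q.den

/-- The real number `x` is a rational that can be written with at most `n` bits. -/
def HasBits (x : ℝ) (n : ℕ) : Prop := ∃ q : ℚ, (q : ℝ) = x ∧ bitLength q ≤ n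

/-- `P` can be described implicitly using `β` bits: some finite system of linear inequalities
that defines `P` has only coefficients with bit complexity at most `β`. -/
def DescribedWithBits (P : Set (Vec k)) (β : ℕ) : Prop :=
  ∃ (m : ℕ) (a : Fin m → Vec k) (d : Fin m → ℝ),
    (∀ i j, HasBits (a i j) β) ∧ (∀ i, HasBits (d i) β) ∧ P = {w | ∀ i, a i ⬝ᵥ w ≤ d i}

/-- The answer of a separation oracle: `none` is "yes", `some (h, c)` is the halfspace
`h ⬝ y ≤ c`. -/
abbrev SepAnswer (k : ℕ) : Type := Option (Vec k × ℝ)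

/-- `so` answers "yes" on the points of `P`, and on any other point `x` it returns a halfspace
that contains `P` but not `x`. -/
def IsSeparationOracle (P : Set (Vec k)) (so : Vec k → SepAnswer k) : Prop :=
  ∀ x, match so x with
    | none => x ∈ P
    | some (h, c) => (∀ y ∈ P, h ⬝ᵥ y ≤ c) ∧ c < h ⬝ᵥ x

/-! ### Oracle programs -/

/-- A program that may query a separation oracle adaptively and then returns a vector. -/
inductive SepProg (k : ℕ) : Type
  | done (w : Vec k) : SepProg k
  | callSep (x : Vec k) (next : SepAnswer k → SepProg k) : SepProg k

/-- The vector returned when the queries are answered by `so`. -/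
def SepProg.run (so : Vec k → SepAnswer k) : SepProg k → Vec k
  | .done w => w
  | .callSep x next => (next (so x)).run so

/-- For every objective `c`, the program `lp c` returns an element of
`argmin_{w ∈ P} w ⬝ c` when its queries are answered by `so`. -/
def MinimizesOver (P : Set (Vec k)) (so : Vec k → SepAnswer k) (lp : Vec k → SepProg k) : Prop :=
  ∀ c, (lp c).run so ∈ P ∧ ∀ w ∈ P, (lp c).run so ⬝ᵥ c ≤ w ⬝ᵥ c

/-- A program that may query an MDP solver (whose answers consist of a policy of type `Pol` and
a feature vector) and a separation oracle, and then returns an element of `α`. -/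
inductive Prog (Pol : Type*) (k : ℕ) (α : Type*)
  | done (a : α) : Prog Pol k α
  | callSolver (v : Vec k) (next : Pol × Vec k → Prog Pol k α) : Prog Pol k α
  | callSep (x : Vec k) (next : SepAnswer k → Prog Pol k α) : Prog Pol k α

section Prog

variable {Pol α α' : Type*}

/-- The output of a program with solver `alg` and separation oracle `so`. -/
def Prog.run (alg : Vec k → Pol × Vec k) (so : Vec k → SepAnswer k) : Prog Pol k α → α
  | .done a => a
  | .callSolver v next => (next (alg v)).run alg so
  | .callSep x next => (next (so x)).run alg so

/-- The number of queries to the solver in a run. -/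
def Prog.solverCalls (alg : Vec k → Pol × Vec k) (so : Vec k → SepAnswer k) :
    Prog Pol k α → ℕ
  | .done _ => 0
  | .callSolver v next => (next (alg v)).solverCalls alg so + 1
  | .callSep x next => (next (so x)).solverCalls alg so

/-- The number of queries to the separation oracle in a run. -/
def Prog.sepCalls (alg : Vec k → Pol × Vec k) (so : Vec k → SepAnswer k) :
    Prog Pol k α → ℕ
  | .done _ => 0
  | .callSolver v next => (next (alg v)).sepCalls alg so
  | .callSep x next => (next (so x)).sepCalls alg so + 1

/-- Sequential composition. -/
def Prog.bind : Prog Pol k α → (α → Prog Pol k α') → Prog Pol k α'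
  | .done a, f => f a
  | .callSolver v next, f => .callSolver v (fun y => (next y).bind f)
  | .callSep x next, f => .callSep x (fun y => (next y).bind f)

/-- A separation-oracle program as a program with both oracles (it never calls the solver). -/
def SepProg.toProg : SepProg k → Prog Pol k (Vec k)
  | .done w => .done w
  | .callSep x next => .callSep x (fun y => (next y).toProg)

end Prog

/-! ### The follow-the-perturbed-leader algorithm -/

/-- What one iteration `t` produces: the policy `πₜ`, its feature vector `μₜ`, and the reward
weights `wₜ`. -/
structure Round (Pol : Type*) (k : ℕ) where
  policy : Pol
  features : Vec k
  weights : Vec k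

/-- One iteration, after the `n` rounds recorded in `h`, with perturbations `p` and `q`.
The solver is called on reward weights `∑ᵢ wᵢ + p`, and `lp` is used to minimize
`w ⬝ (∑ᵢ μᵢ + q)` over the reward polytope. -/
def fplIteration {Pol : Type*} (lp : Vec k → SepProg k) {n : ℕ} (h : Fin n → Round Pol k)
    (p q : Vec k) : Prog Pol k (Round Pol k) :=
  .callSolver (∑ i, (h i).weights + p) fun y =>
    (lp (∑ i, (h i).features + q)).toProg.bind fun w => .done ⟨y.1, y.2, w⟩

/-- `T` iterations, with perturbations `p t` and `q t` in iteration `t`. -/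
def fplRounds {Pol : Type*} (lp : Vec k → SepProg k) :
    (T : ℕ) → (p q : Fin T → Vec k) → Prog Pol k (Fin T → Round Pol k)
  | 0, _, _ => .done Fin.elim0
  | T + 1, p, q =>
      (fplRounds lp T (fun t => p t.castSucc) (fun t => q t.castSucc)).bind fun h =>
        (fplIteration lp h (p (Fin.last T)) (q (Fin.last T))).bind fun r =>
          .done (Fin.snoc (α := fun _ => Round Pol k) h r)

/-- The policies `π₁, …, π_T` computed by the algorithm; its output is the randomized policy
`(1/T) ∑ₜ πₜ`. -/
def fplPolicies {Pol : Type*} (alg : Vec k → Pol × Vec k) (so : Vec k → SepAnswer k)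
    (lp : Vec k → SepProg k) (T : ℕ) (p q : Fin T → Vec k) : Fin T → Pol :=
  fun t => ((fplRounds lp T p q).run alg so t).policy

/-- The parameter `δ = 1 / (k √T)`. -/
def fplDelta (k T : ℕ) : ℝ := 1 / (k * √(T : ℝ))

/-- The uniform distribution on the cube `[0, 1/δ]^k`. -/
def uniformCube (k : ℕ) (δ : ℝ) : Measure (Vec k) :=
  ProbabilityTheory.cond volume (Set.Icc (0 : Vec k) (fun _ => 1 / δ))

/-- The law of all perturbations `(p₁, …, p_T, q₁, …, q_T)`: independent and uniform on
`[0, 1/δ]^k` with `δ = 1 / (k √T)`. -/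
def perturbationLaw (k T : ℕ) : Measure ((Fin T → Vec k) × (Fin T → Vec k)) :=
  (Measure.pi fun _ : Fin T => uniformCube k (fplDelta k T)).prod
    (Measure.pi fun _ : Fin T => uniformCube k (fplDelta k T))

end

end MaxminRL

open MaxminRL

/-!
The first part is a regret argument for a zero-sum game between the solver, whose responses
`μₜ = F (Wₜ₋₁ + pₜ)` maximize over the feature vectors, and the minimization step, whose responses
`wₜ = G (Mₜ₋₁ + qₜ)` minimize over the reward polytope; `Wₜ` and `Mₜ` are the accumulated weights
and features. Averaging the support function of the feature vectors over the noise `p`, and that of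
the negated reward polytope over the noise `q`, gives the `potential` of the state `(W, M)`.
When a player's argument moves by the opponent's response, its smoothed support function grows by at
most the gain of its mean response, plus the cost of the small non-overlap of two translated cubes
(`IsLinearMaximizer.smoothedSupport_add_sub_le`). The mean gains of both players cancel, because
the game has sum zero and the two perturbations of a round are independent
(`IsGame.integral_drift`), so Hoeffding's lemma bounds the exponential moment of the potential
round by round (`IsGame.lintegral_exp_fplState_le`), and Markov's inequality keeps the potential
small with high probability. A small potential is exactly what makes the accumulated features good
against every `w` (`IsGame.le_dotProduct_snd`): the final weights satisfy
`μ ⬝ W ≥ T v` for a maxmin strategy `μ`, so neither a minimax theorem nor convexity of the set of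
feature vectors is needed. The maxmin value exists since the feature vectors are a continuous image
of the compact space of policies.

Solver and minimizer may break ties arbitrarily, even non-measurably. This does not matter: by
Rademacher's theorem the support function is differentiable almost everywhere, where the maximizer
is unique (`IsLinearMaximizer.aemeasurable`), and the noise has a density.

For the second part, a linear objective attains its minimum at a vertex, and all vertices lie in the
finite set of solutions of square systems with `β`-bit coefficients, of size `2 ^ O(k² β)`
(`exists_isMinimizer_vertexCandidates`, `card_vertexCandidates_le`). Querying the oracle at a
centerpoint of the remaining candidates, which exists by Helly's theorem
(`exists_isCenterpoint`), discards at least the fraction `1 / (k + 1)` of them: an infeasible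
centerpoint is cut off by the oracle's halfspace, a feasible one by the objective. Hence `O(k³ β)`
queries suffice, whatever the objective and whatever the dimension of the polytope.
-/

namespace MaxminRL

noncomputable section

/-! ### Centerpoints of finite sets -/

/-- `x` is a centerpoint of the finite set `V`: every closed halfspace with `x` on its boundary
contains at least the fraction `1 / (k + 1)` of `V`. -/
def IsCenterpoint {k : ℕ} (V : Finset (Vec k)) (x : Vec k) : Prop :=
  ∀ h : Vec k, V.card ≤ (k + 1) * {y ∈ V | h ⬝ᵥ x ≤ h ⬝ᵥ y}.card

/-- The centerpoint theorem. The convex hulls of those subsets of `V` that miss fewer than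
`V.card / (k + 1)` points have a common point by Helly's theorem, because any `k + 1` of these
subsets already share a point of `V`. -/
theorem exists_isCenterpoint {k : ℕ} (V : Finset (Vec k)) : ∃ x, IsCenterpoint V x := by
  classical
  rcases V.eq_empty_or_nonempty with rfl | hV
  · exact ⟨0, fun h => by simp⟩
  let s : Finset (Finset (Vec k)) := {U ∈ V.powerset | (k + 1) * (V \ U).card < V.card}
  obtain ⟨x, hx⟩ : (⋂ U ∈ s, convexHull ℝ (U : Set (Vec k))).Nonempty := by
    refine Convex.helly_theorem' (𝕜 := ℝ) (fun U _ => convex_convexHull ℝ _) fun I hI hcard => ?_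
    rw [Module.finrank_fin_fun] at hcard
    have hlt : (I.biUnion fun U => V \ U).card < V.card := by
      have h2 : ∀ U ∈ I, (k + 1) * (V \ U).card ≤ V.card - 1 := fun U hU => by
        have := (Finset.mem_filter.1 (hI hU)).2
        omega
      have h3 : (k + 1) * (I.biUnion fun U => V \ U).card ≤ (k + 1) * (V.card - 1) :=
        calc (k + 1) * (I.biUnion fun U => V \ U).card
            ≤ (k + 1) * ∑ U ∈ I, (V \ U).card := by gcongr; exact Finset.card_biUnion_le
          _ = ∑ U ∈ I, (k + 1) * (V \ U).card := Finset.mul_sum _ _ _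
          _ ≤ ∑ _U ∈ I, (V.card - 1) := Finset.sum_le_sum h2
          _ = I.card * (V.card - 1) := by simp
          _ ≤ (k + 1) * (V.card - 1) := by gcongr
      have := Nat.le_of_mul_le_mul_left h3 (Nat.succ_pos k)
      have := hV.card_pos
      omega
    obtain ⟨y, hyV, hy⟩ := Finset.exists_mem_notMem_of_card_lt_card hlt
    refine ⟨y, Set.mem_iInter₂.2 fun U hU => subset_convexHull ℝ _ ?_⟩
    by_contra hyU
    exact hy (Finset.mem_biUnion.2 ⟨U, hU, Finset.mem_sdiff.2 ⟨hyV, hyU⟩⟩)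
  refine ⟨x, fun h => ?_⟩
  by_contra! hlt
  let U : Finset (Vec k) := {y ∈ V | h ⬝ᵥ y < h ⬝ᵥ x}
  have hVU : V \ U = {y ∈ V | h ⬝ᵥ x ≤ h ⬝ᵥ y} := by
    ext y; simp only [U, Finset.mem_sdiff, Finset.mem_filter]; grind
  have hU : U ∈ s := by
    refine Finset.mem_filter.2 ⟨Finset.mem_powerset.2 (Finset.filter_subset _ _), ?_⟩
    rw [hVU]
    exact hlt
  have hxU : x ∈ convexHull ℝ (U : Set (Vec k)) := Set.mem_iInter₂.1 hx U hU
  have hsub : convexHull ℝ (U : Set (Vec k)) ⊆ {y | h ⬝ᵥ y < h ⬝ᵥ x} := by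
    refine convexHull_min (fun y hy => (Finset.mem_filter.1 hy).2) ?_
    exact convex_halfSpace_lt
      ⟨fun a b => dotProduct_add h a b, fun r a => dotProduct_smul r h a⟩ _
  exact lt_irrefl (h ⬝ᵥ x) (hsub hxU)

/-- A chosen centerpoint of `V`. -/
def centerpoint {k : ℕ} (V : Finset (Vec k)) : Vec k := (exists_isCenterpoint V).choose

theorem isCenterpoint_centerpoint {k : ℕ} (V : Finset (Vec k)) :
    IsCenterpoint V (centerpoint V) := (exists_isCenterpoint V).choose_spec

/-- Discarding a closed halfspace through a centerpoint, and possibly more, leaves at most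
the fraction `k / (k + 1)` of the points. -/
theorem IsCenterpoint.card_le {k : ℕ} {V W : Finset (Vec k)} {x : Vec k} (hx : IsCenterpoint V x)
    (h : Vec k) (hWV : W ⊆ V) (hW : ∀ y ∈ W, h ⬝ᵥ y < h ⬝ᵥ x) :
    (k + 1) * W.card ≤ k * V.card := by
  classical
  have h1 := hx h
  have hdisj : Disjoint W {y ∈ V | h ⬝ᵥ x ≤ h ⬝ᵥ y} :=
    Finset.disjoint_left.2 fun y hy hy' => not_lt.2 (Finset.mem_filter.1 hy').2 (hW y hy)
  have h2 : W.card + {y ∈ V | h ⬝ᵥ x ≤ h ⬝ᵥ y}.card ≤ V.card := by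
    rw [← Finset.card_union_of_disjoint hdisj]
    exact Finset.card_le_card (Finset.union_subset hWV (Finset.filter_subset _ _))
  nlinarith

/-! ### Minimization by centerpoint cuts -/

open Classical in
/-- Minimization of `w ⬝ c` with at most `N` queries. `V` holds the points that may still be
better than the best feasible point `best` found so far; the oracle is queried at a
centerpoint of `V`. -/
def cutProg {k : ℕ} (c : Vec k) : ℕ → Finset (Vec k) → Vec k → SepProg k
  | 0, _, best => .done best
  | N + 1, V, best =>
      if V = ∅ then .done best else
        .callSep (centerpoint V) fun
          | none => cutProg c N {y ∈ V | y ⬝ᵥ c < centerpoint V ⬝ᵥ c} (centerpoint V)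
          | some hd => cutProg c N {y ∈ V | hd.1 ⬝ᵥ y ≤ hd.2} best

/-- `v` minimizes `w ⬝ c` over `w ∈ P`. -/
def IsMinimizer {k : ℕ} (P : Set (Vec k)) (c v : Vec k) : Prop :=
  v ∈ P ∧ ∀ w ∈ P, v ⬝ᵥ c ≤ w ⬝ᵥ c

/-- Either a minimizer is still among the candidates `V`, or `best` is a minimizer and the
candidates are all strictly better in objective value, hence infeasible. The cardinality hypothesis
says that `N` cuts exhaust `V`. -/
theorem isMinimizer_cutProg_run {k : ℕ} {P : Set (Vec k)} {so : Vec k → SepAnswer k}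
    (hso : IsSeparationOracle P so) (c : Vec k) (N : ℕ) (V : Finset (Vec k)) (best : Vec k)
    (hcard : V.card * k ^ N < (k + 1) ^ N)
    (hinv : (∃ v ∈ V, IsMinimizer P c v) ∨
      (IsMinimizer P c best ∧ ∀ y ∈ V, y ⬝ᵥ c < best ⬝ᵥ c)) :
    IsMinimizer P c ((cutProg c N V best).run so) := by
  classical
  induction N generalizing V best with
  | zero =>
    have hV : V = ∅ := by simpa using hcard
    subst hV
    simpa [cutProg, SepProg.run] using hinv
  | succ N ih =>
    rw [cutProg]
    split_ifs with hV
    · subst hV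
      simpa [SepProg.run] using hinv
    have hctr := isCenterpoint_centerpoint V
    set x := centerpoint V with hxdef
    have hstep : ∀ W : Finset (Vec k), (k + 1) * W.card ≤ k * V.card →
        W.card * k ^ N < (k + 1) ^ N := fun W hW => by
      refine lt_of_mul_lt_mul_left (a := k + 1) ?_ (Nat.zero_le _)
      calc (k + 1) * (W.card * k ^ N) = ((k + 1) * W.card) * k ^ N := by ring
        _ ≤ (k * V.card) * k ^ N := by gcongr
        _ = V.card * k ^ (N + 1) := by ring
        _ < (k + 1) ^ (N + 1) := hcard
        _ = (k + 1) * (k + 1) ^ N := by ring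
    have hans := hso x
    rw [SepProg.run]
    rcases hsx : so x with _ | ⟨h, d⟩
    · rw [hsx] at hans
      refine ih _ _ (hstep _ (hctr.card_le c (Finset.filter_subset _ _) fun y hy => ?_)) ?_
      · simpa [dotProduct_comm c] using (Finset.mem_filter.1 hy).2
      · rcases hinv with ⟨v, hvV, hv⟩ | ⟨hbest, hlt⟩
        · by_cases hvx : v ⬝ᵥ c < x ⬝ᵥ c
          · exact Or.inl ⟨v, Finset.mem_filter.2 ⟨hvV, hvx⟩, hv⟩
          · exact Or.inr ⟨⟨hans, fun w hw => (not_lt.1 hvx).trans (hv.2 w hw)⟩,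
              fun y hy => (Finset.mem_filter.1 hy).2⟩
        · -- a feasible centerpoint would be better than the optimal `best`
          obtain ⟨y, hy⟩ : {y ∈ V | c ⬝ᵥ x ≤ c ⬝ᵥ y}.Nonempty := by
            rw [← Finset.card_pos]
            have h1 := hctr c
            have h2 := (Finset.nonempty_iff_ne_empty.2 hV).card_pos
            exact Nat.pos_of_mul_pos_left (h2.trans_le h1)
          rw [Finset.mem_filter, dotProduct_comm c, dotProduct_comm c] at hy
          exact absurd (hbest.2 x hans) (not_le.2 (hy.2.trans_lt (hlt y hy.1)))
    · rw [hsx] at hans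
      refine ih _ _ (hstep _ (hctr.card_le h (Finset.filter_subset _ _) fun y hy => ?_)) ?_
      · exact (Finset.mem_filter.1 hy).2.trans_lt hans.2
      · rcases hinv with ⟨v, hvV, hv⟩ | ⟨hbest, hlt⟩
        · exact Or.inl ⟨v, Finset.mem_filter.2 ⟨hvV, hans.1 v hv.1⟩, hv⟩
        · exact Or.inr ⟨hbest, fun y hy => hlt y (Finset.mem_filter.1 hy).1⟩

theorem sepCalls_cutProg_le {Pol : Type*} {k : ℕ} (alg : Vec k → Pol × Vec k)
    (so : Vec k → SepAnswer k) (c : Vec k) (N : ℕ) (V : Finset (Vec k)) (best : Vec k) :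
    ((cutProg c N V best).toProg (Pol := Pol)).sepCalls alg so ≤ N := by
  classical
  induction N generalizing V best with
  | zero => simp [cutProg, SepProg.toProg, Prog.sepCalls]
  | succ N ih =>
    rw [cutProg]
    split_ifs with hV
    · simp [SepProg.toProg, Prog.sepCalls]
    · rw [SepProg.toProg, Prog.sepCalls]
      gcongr
      rcases so (centerpoint V) with _ | ⟨h, d⟩ <;> exact ih _ _

/-! ### The vertices of a polytope with short coefficients -/

/-- A finite set of reals that contains all rationals of at most `β` bits. -/
def shortRationals (β : ℕ) : Finset ℝ :=
  ((Finset.Ico (-2 ^ β : ℤ) (2 ^ β)) ×ˢ Finset.range (2 ^ β)).image fun z => (z.1 : ℝ) / z.2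

theorem HasBits.mem_shortRationals {x : ℝ} {β : ℕ} (h : HasBits x β) : x ∈ shortRationals β := by
  obtain ⟨q, rfl, hq⟩ := h
  unfold bitLength at hq
  have h1 : q.num.natAbs < 2 ^ β := Nat.size_le.1 (by omega)
  have h2 : q.den < 2 ^ β := Nat.size_le.1 (by omega)
  refine Finset.mem_image.2 ⟨(q.num, q.den), ?_, by simp [← Rat.cast_def]⟩
  simp only [Finset.mem_product, Finset.mem_Ico, Finset.mem_range]
  zify at h1
  rw [abs_lt] at h1
  exact ⟨⟨h1.1.le, h1.2⟩, h2⟩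

theorem card_shortRationals_le (β : ℕ) : (shortRationals β).card ≤ 2 ^ (2 * β + 1) := by
  refine Finset.card_image_le.trans (le_of_eq ?_)
  rw [Finset.card_product, Int.card_Ico, Finset.card_range]
  have : ((2 : ℤ) ^ β - -2 ^ β).toNat = 2 * 2 ^ β := by
    rw [sub_neg_eq_add, ← two_mul]
    exact_mod_cast Int.toNat_natCast (2 * 2 ^ β)
  rw [this]
  ring

/-- The candidates `A⁻¹ b` for a vertex, over all square systems `A x = b` with short
coefficients. (A singular `A` contributes the harmless junk value `0`.) -/
def vertexCandidates (k β : ℕ) : Finset (Vec k) :=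
  ((Fintype.piFinset fun _ : Fin k => Fintype.piFinset fun _ : Fin k => shortRationals β) ×ˢ
    Fintype.piFinset fun _ : Fin k => shortRationals β).image
      fun z => (Matrix.of z.1)⁻¹.mulVec z.2

theorem card_vertexCandidates_le (k β : ℕ) :
    (vertexCandidates k β).card ≤ 2 ^ ((2 * β + 1) * (k * (k + 1))) := by
  refine Finset.card_image_le.trans ?_
  simp only [Finset.card_product, Fintype.card_piFinset, Finset.prod_const, Finset.card_univ,
    Fintype.card_fin]
  calc ((shortRationals β).card ^ k) ^ k * (shortRationals β).card ^ k
      ≤ ((2 ^ (2 * β + 1)) ^ k) ^ k * (2 ^ (2 * β + 1)) ^ k := by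
        gcongr <;> exact card_shortRationals_le β
    _ = 2 ^ ((2 * β + 1) * (k * (k + 1))) := by
        rw [← pow_mul, ← pow_mul, ← pow_mul, ← pow_add]; ring_nf

/-- The normals of the constraints that are tight at an extreme point separate points:
otherwise the extreme point could be moved both ways along a common orthogonal direction. -/
theorem eq_zero_of_tight_orthogonal {k m : ℕ} {a : Fin m → Vec k} {d : Fin m → ℝ} {x : Vec k}
    (hx : x ∈ Set.extremePoints ℝ {w : Vec k | ∀ i, a i ⬝ᵥ w ≤ d i}) {u : Vec k}
    (hu : ∀ i, a i ⬝ᵥ x = d i → a i ⬝ᵥ u = 0) : u = 0 := by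
  have hev : ∀ᶠ ε : ℝ in nhds 0, ∀ i, a i ⬝ᵥ (x + ε • u) ≤ d i := by
    rw [Filter.eventually_all]
    intro i
    rcases (hx.1 i).eq_or_lt with h | h
    · refine Filter.Eventually.of_forall fun ε => ?_
      rw [dotProduct_add, dotProduct_smul, hu i h, h]
      simp
    · have hc : Continuous fun ε : ℝ => a i ⬝ᵥ (x + ε • u) := by
        unfold dotProduct; fun_prop
      have : Filter.Tendsto (fun ε : ℝ => a i ⬝ᵥ (x + ε • u)) (nhds 0) (nhds (a i ⬝ᵥ x)) := by
        simpa using hc.tendsto 0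
      exact (this.eventually_lt_const h).mono fun _ => le_of_lt
  obtain ⟨ε, hε, hball⟩ := Metric.eventually_nhds_iff.1 hev
  have h1 := @hball (ε / 2) (by rw [Real.dist_eq, sub_zero, abs_of_pos (by linarith)]; linarith)
  have h2 := @hball (-(ε / 2)) (by
    rw [Real.dist_eq, sub_zero, abs_neg, abs_of_pos (by linarith)]; linarith)
  have hseg : x ∈ openSegment ℝ (x + (ε / 2) • u) (x + (-(ε / 2)) • u) :=
    ⟨1 / 2, 1 / 2, by norm_num, by norm_num, by norm_num, by module⟩
  have := hx.2 h1 h2 hseg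
  simpa [hε.ne'] using this

/-- The normals of the tight constraints span, so `k` of them form a basis and the extreme point is
the solution of the corresponding square system. -/
theorem DescribedWithBits.extremePoints_subset {k β : ℕ} {P : Set (Vec k)}
    (hP : DescribedWithBits P β) :
    P.extremePoints ℝ ⊆ (vertexCandidates k β : Set (Vec k)) := by
  obtain ⟨m, a, d, ha, hd, rfl⟩ := hP
  intro x hx
  have hspan : Submodule.span ℝ (a '' {i | a i ⬝ᵥ x = d i}) = ⊤ := by
    by_contra hne
    obtain ⟨f, hf, hle⟩ := Submodule.exists_le_ker_of_lt_top _ (lt_top_iff_ne_top.2 hne)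
    let u : Vec k := fun j => f (Pi.single j 1)
    have hfu : ∀ v : Vec k, f v = v ⬝ᵥ u := fun v => by
      conv_lhs => rw [pi_eq_sum_univ' v, map_sum]
      simp [dotProduct, u]
    have hu : u = 0 := eq_zero_of_tight_orthogonal hx fun i hi => by
      rw [← hfu]
      exact hle (Submodule.subset_span ⟨i, hi, rfl⟩)
    exact hf (LinearMap.ext fun v => by rw [hfu, hu]; simp)
  obtain ⟨B, hBsub, hBspan, hBli⟩ := exists_linearIndependent ℝ (a '' {i | a i ⬝ᵥ x = d i})
  rw [hspan] at hBspan
  let bas : Module.Basis B ℝ (Vec k) := Module.Basis.mk hBli (by simp [hBspan])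
  let e : Fin k ≃ B := (Pi.basisFun ℝ (Fin k)).indexEquiv bas
  choose g hg using fun j : Fin k => hBsub (e j).2
  have hli : LinearIndependent ℝ fun j => a (g j) := by
    have hge : (fun j => a (g j)) = Subtype.val ∘ e := funext fun j => (hg j).2
    rw [hge]
    exact hBli.comp e e.injective
  have hunit : IsUnit (Matrix.of fun j => a (g j)) := Matrix.linearIndependent_rows_iff_isUnit.1 hli
  refine Finset.mem_coe.2 (Finset.mem_image.2 ⟨(fun j => a (g j), fun j => d (g j)), ?_, ?_⟩)
  · simp only [Finset.mem_product, Fintype.mem_piFinset]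
    exact ⟨fun i j => (ha _ _).mem_shortRationals, fun i => (hd _).mem_shortRationals⟩
  · have hAx : (Matrix.of fun j => a (g j)).mulVec x = fun j => d (g j) :=
      funext fun j => (hg j).1
    simp only [← hAx, Matrix.mulVec_mulVec]
    rw [Matrix.nonsing_inv_mul _ ((Matrix.isUnit_iff_isUnit_det _).1 hunit), Matrix.one_mulVec]

theorem IsPolyhedron.isCompact {k : ℕ} {P : Set (Vec k)} (hP : IsPolyhedron P)
    (hbox : P ⊆ Set.Icc (fun _ => -1) (fun _ => 1)) : IsCompact P := by
  obtain ⟨m, a, d, rfl⟩ := hP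
  refine isCompact_Icc.of_isClosed_subset ?_ hbox
  simp only [Set.ofPred_forall]
  exact isClosed_iInter fun i => isClosed_le (by unfold dotProduct; fun_prop) continuous_const

theorem DescribedWithBits.isPolyhedron {k β : ℕ} {P : Set (Vec k)} (hP : DescribedWithBits P β) :
    IsPolyhedron P := by
  obtain ⟨m, a, d, -, -, h⟩ := hP
  exact ⟨m, a, d, h⟩

/-- A linear objective attains its minimum over a polytope at a vertex: the face of minimizers
has an extreme point by the Krein–Milman theorem. -/
theorem exists_isMinimizer_vertexCandidates {k β : ℕ} {P : Set (Vec k)}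
    (hP : DescribedWithBits P β) (hne : P.Nonempty)
    (hbox : P ⊆ Set.Icc (fun _ => -1) (fun _ => 1)) (c : Vec k) :
    ∃ v ∈ vertexCandidates k β, IsMinimizer P c v := by
  have hcomp := hP.isPolyhedron.isCompact hbox
  let l : StrongDual ℝ (Vec k) := LinearMap.toContinuousLinearMap
    { toFun := fun w => -(w ⬝ᵥ c)
      map_add' := fun v w => by rw [add_dotProduct]; ring
      map_smul' := fun r w => by simp }
  have hl : ∀ w, l w = -(w ⬝ᵥ c) := fun w => rfl
  have hexp : IsExposed ℝ P (l.toExposed P) := ContinuousLinearMap.toExposed.isExposed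
  obtain ⟨v, hv, hmax⟩ := hcomp.exists_isMaxOn hne l.continuous.continuousOn
  obtain ⟨x, hx⟩ := (hexp.isCompact hcomp).extremePoints_nonempty ⟨v, hv, hmax⟩
  refine ⟨x, hP.extremePoints_subset (hexp.isExtreme.extremePoints_subset_extremePoints hx),
    hx.1.1, fun w hw => ?_⟩
  have := hx.1.2 w hw
  rw [hl, hl] at this
  linarith

/-! ### The query bound -/

/-- The number of rounds of centerpoint cuts that exhausts the vertex candidates. -/
def cutRounds (k β : ℕ) : ℕ := (k + 1) * (2 * (β + 1) * (k * (k + 1)))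

/-- Bernoulli's inequality: `k + 1` cuts halve the number of candidates. -/
theorem two_mul_pow_le (k : ℕ) : 2 * k ^ (k + 1) ≤ (k + 1) ^ (k + 1) := by
  have key : ∀ n : ℕ, k ^ n * (k + n) ≤ (k + 1) ^ n * k := fun n => by
    induction n with
    | zero => simp
    | succ n ih =>
      calc k ^ (n + 1) * (k + (n + 1)) ≤ (k + 1) * (k ^ n * (k + n)) := by
            have : k * (k + (n + 1)) ≤ (k + 1) * (k + n) := by nlinarith
            calc k ^ (n + 1) * (k + (n + 1)) = k ^ n * (k * (k + (n + 1))) := by ring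
              _ ≤ k ^ n * ((k + 1) * (k + n)) := by gcongr
              _ = _ := by ring
        _ ≤ (k + 1) * ((k + 1) ^ n * k) := by gcongr
        _ = _ := by ring
  rcases Nat.eq_zero_or_pos k with rfl | hk
  · simp
  · refine Nat.le_of_mul_le_mul_right (c := k) ?_ hk
    calc 2 * k ^ (k + 1) * k ≤ k ^ (k + 1) * (k + (k + 1)) := by
          have : 0 ≤ k ^ (k + 1) := Nat.zero_le _
          nlinarith
      _ ≤ _ := key (k + 1)

theorem card_vertexCandidates_mul_lt {k : ℕ} (hk : 0 < k) (β : ℕ) :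
    (vertexCandidates k β).card * k ^ cutRounds k β < (k + 1) ^ cutRounds k β := by
  obtain ⟨E, hE⟩ : ∃ E, E = 2 * (β + 1) * (k * (k + 1)) := ⟨_, rfl⟩
  have hN : cutRounds k β = (k + 1) * E := by rw [hE, cutRounds]
  have h1 : (vertexCandidates k β).card < 2 ^ E := by
    rw [hE]
    refine (card_vertexCandidates_le k β).trans_lt (Nat.pow_lt_pow_right (by norm_num) ?_)
    have : 0 < k * (k + 1) := by positivity
    exact Nat.mul_lt_mul_of_pos_right (by omega) this
  calc (vertexCandidates k β).card * k ^ cutRounds k β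
      < 2 ^ E * k ^ cutRounds k β := Nat.mul_lt_mul_of_pos_right h1 (by positivity)
    _ = (2 * k ^ (k + 1)) ^ E := by rw [hN, pow_mul, mul_pow]
    _ ≤ ((k + 1) ^ (k + 1)) ^ E := by gcongr; exact two_mul_pow_le k
    _ = (k + 1) ^ cutRounds k β := by rw [hN, pow_mul]

/-- Exact minimization of a linear objective over a polytope with `β`-bit coefficients. -/
def exactMinimizer (k β : ℕ) (c : Vec k) : SepProg k :=
  cutProg c (cutRounds k β) (vertexCandidates k β) 0

theorem minimizesOver_exactMinimizer {k β : ℕ} (hk : 0 < k) {P : Set (Vec k)}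
    {so : Vec k → SepAnswer k} (hP : DescribedWithBits P β) (hne : P.Nonempty)
    (hbox : P ⊆ Set.Icc (fun _ => -1) (fun _ => 1)) (hso : IsSeparationOracle P so) :
    MinimizesOver P so (exactMinimizer k β) := fun c =>
  isMinimizer_cutProg_run hso c _ _ _ (card_vertexCandidates_mul_lt hk β)
    (Or.inl (exists_isMinimizer_vertexCandidates hP hne hbox c))

section Counting

variable {Pol α α' : Type*} {k : ℕ} (alg : Vec k → Pol × Vec k) (so : Vec k → SepAnswer k)

theorem Prog.run_bind (f : α → Prog Pol k α') (p : Prog Pol k α) :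
    (p.bind f).run alg so = (f (p.run alg so)).run alg so := by
  induction p with
  | done a => rfl
  | callSolver v next ih => exact ih _
  | callSep x next ih => exact ih _

theorem Prog.solverCalls_bind (f : α → Prog Pol k α') (p : Prog Pol k α) :
    (p.bind f).solverCalls alg so =
      p.solverCalls alg so + (f (p.run alg so)).solverCalls alg so := by
  induction p with
  | done a => simp [Prog.bind, Prog.solverCalls, Prog.run]
  | callSolver v next ih => simp only [Prog.bind, Prog.solverCalls, Prog.run, ih]; ring
  | callSep x next ih => simp only [Prog.bind, Prog.solverCalls, Prog.run, ih]

theorem Prog.sepCalls_bind (f : α → Prog Pol k α') (p : Prog Pol k α) :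
    (p.bind f).sepCalls alg so = p.sepCalls alg so + (f (p.run alg so)).sepCalls alg so := by
  induction p with
  | done a => simp [Prog.bind, Prog.sepCalls, Prog.run]
  | callSolver v next ih => simp only [Prog.bind, Prog.sepCalls, Prog.run, ih]
  | callSep x next ih => simp only [Prog.bind, Prog.sepCalls, Prog.run, ih]; ring

theorem SepProg.run_toProg (p : SepProg k) : (p.toProg (Pol := Pol)).run alg so = p.run so := by
  induction p with
  | done a => rfl
  | callSep x next ih => exact ih _

theorem SepProg.solverCalls_toProg (p : SepProg k) :
    (p.toProg (Pol := Pol)).solverCalls alg so = 0 := by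
  induction p with
  | done a => rfl
  | callSep x next ih => exact ih _

theorem solverCalls_fplIteration (lp : Vec k → SepProg k) {n : ℕ} (h : Fin n → Round Pol k)
    (p q : Vec k) : (fplIteration lp h p q).solverCalls alg so = 1 := by
  simp [fplIteration, Prog.solverCalls, Prog.solverCalls_bind, SepProg.solverCalls_toProg]

theorem sepCalls_fplIteration_exactMinimizer_le (β : ℕ) {n : ℕ} (h : Fin n → Round Pol k)
    (p q : Vec k) :
    (fplIteration (exactMinimizer k β) h p q).sepCalls alg so ≤ cutRounds k β := by
  simpa [fplIteration, exactMinimizer, Prog.sepCalls, Prog.sepCalls_bind] using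
    sepCalls_cutProg_le alg so _ (cutRounds k β) (vertexCandidates k β) 0

end Counting

/-- A rational number takes at least two bits, so the quantity `L` on the right is at least
`2 * k + β`, and `k ^ 2 * L ^ 2` dominates the `O(k ^ 3 * β)` queries of the centerpoint cuts. -/
theorem cutRounds_le {k β : ℕ} (hk : 0 < k) {L : ℝ} (hL : 2 * (k : ℝ) + β ≤ L) (l : ℝ) :
    (cutRounds k β : ℝ) ≤ 3 * ((k : ℝ) ^ 2 * (l ^ 2 + L ^ 2)) := by
  have hk1 : (1 : ℝ) ≤ k := by exact_mod_cast hk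
  have hβ : (0 : ℝ) ≤ β := Nat.cast_nonneg β
  have h1 : (cutRounds k β : ℝ) = 2 * (β + 1) * (k * (k + 1) ^ 2) := by
    rw [cutRounds]; push_cast; ring
  have h2 : (k : ℝ) * (k + 1) ^ 2 ≤ 4 * (k : ℝ) ^ 3 := by
    have : ((k : ℝ) + 1) ^ 2 ≤ 4 * k ^ 2 := by nlinarith
    calc (k : ℝ) * (k + 1) ^ 2 ≤ k * (4 * k ^ 2) := by gcongr
      _ = 4 * (k : ℝ) ^ 3 := by ring
  have hL2 : (2 * (k : ℝ) + β) ^ 2 ≤ L ^ 2 := by gcongr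
  have h3 : 8 * (k * (β + 1)) ≤ 3 * (l ^ 2 + L ^ 2) := by
    nlinarith [sq_nonneg (2 * (k : ℝ) - β), sq_nonneg l, sq_nonneg (β : ℝ)]
  calc (cutRounds k β : ℝ) = 2 * (β + 1) * (k * (k + 1) ^ 2) := h1
    _ ≤ 2 * (β + 1) * (4 * k ^ 3) := by gcongr
    _ = k ^ 2 * (8 * (k * (β + 1))) := by ring
    _ ≤ k ^ 2 * (3 * (l ^ 2 + L ^ 2)) := by gcongr
    _ = _ := by ring

theorem HasBits.two_le {x : ℝ} {n : ℕ} (h : HasBits x n) : 2 ≤ n := by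
  obtain ⟨q, -, hq⟩ := h
  have : 0 < q.den.size := Nat.size_pos.2 q.den_pos
  unfold bitLength at hq
  omega

/-! ### Feature expectations -/

section FeatureExpectations

variable {S A : Type*} [Fintype S] [Fintype A] {k : ℕ} (M : RewardlessMDP S A k)

theorem stateDist_nonneg (π : Policy S A) (n : ℕ) (s : S) : 0 ≤ stateDist M π n s := by
  induction n generalizing s with
  | zero => exact M.init.2.1 s
  | succ n ih =>
    exact Finset.sum_nonneg fun s' _ => Finset.sum_nonneg fun a _ =>
      mul_nonneg (mul_nonneg (ih s') ((π s').2.1 a)) ((M.trans s' a).2.1 s)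

theorem sum_stateDist (π : Policy S A) (n : ℕ) : ∑ s, stateDist M π n s = 1 := by
  induction n with
  | zero => exact M.init.2.2
  | succ n ih =>
    have htr : ∀ s a, ∑ s', (M.trans s a : S → ℝ) s' = 1 := fun s a => (M.trans s a).2.2
    have hπ : ∀ s, ∑ a, (π s : A → ℝ) a = 1 := fun s => (π s).2.2
    calc ∑ s', stateDist M π (n + 1) s'
        = ∑ s, ∑ a, ∑ s', stateDist M π n s * (π s : A → ℝ) a * (M.trans s a : S → ℝ) s' := by
          simp only [stateDist]
          rw [Finset.sum_comm]
          exact Finset.sum_congr rfl fun s _ => Finset.sum_comm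
      _ = 1 := by simp only [← Finset.mul_sum, htr, hπ, mul_one, ih]

theorem continuous_stateDist (n : ℕ) (s : S) : Continuous fun π => stateDist M π n s := by
  induction n generalizing s with
  | zero => exact continuous_const
  | succ n ih =>
    have hπ : ∀ (s' : S) (a : A), Continuous fun π : Policy S A => (π s' : A → ℝ) a :=
      fun s' a => (continuous_apply a).comp (continuous_subtype_val.comp (continuous_apply s'))
    exact continuous_finsetSum _ fun s' _ => continuous_finsetSum _ fun a _ =>
      ((ih s').mul (hπ s' a)).mul continuous_const

theorem discounted_feat_mem_Icc (π : Policy S A) (j : Fin k) (n : ℕ) :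
    M.discount ^ n * ∑ s, stateDist M π n s * M.feat s j ∈ Set.Icc 0 (M.discount ^ n) := by
  have hγ := pow_nonneg M.discount_nonneg n
  have h0 : 0 ≤ ∑ s, stateDist M π n s * M.feat s j :=
    Finset.sum_nonneg fun s _ => mul_nonneg (stateDist_nonneg M π n s) (M.feat_mem s j).1
  have h1 : ∑ s, stateDist M π n s * M.feat s j ≤ 1 := by
    rw [← sum_stateDist M π n]
    exact Finset.sum_le_sum fun s _ =>
      mul_le_of_le_one_right (stateDist_nonneg M π n s) (M.feat_mem s j).2
  exact ⟨mul_nonneg hγ h0, mul_le_of_le_one_right hγ h1⟩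

theorem summable_discounted_feat (π : Policy S A) (j : Fin k) :
    Summable fun n => M.discount ^ n * ∑ s, stateDist M π n s * M.feat s j :=
  Summable.of_nonneg_of_le (fun n => (discounted_feat_mem_Icc M π j n).1)
    (fun n => (discounted_feat_mem_Icc M π j n).2)
    (summable_geometric_of_lt_one M.discount_nonneg M.discount_lt_one)

theorem featureExp_nonneg (π : Policy S A) (j : Fin k) : 0 ≤ featureExp M π j :=
  tsum_nonneg fun n => (discounted_feat_mem_Icc M π j n).1

theorem value_eq (π : Policy S A) (w : Vec k) : value M π w = w ⬝ᵥ featureExp M π := by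
  have hterm : ∀ n, M.discount ^ n * ∑ s, stateDist M π n s * (w ⬝ᵥ M.feat s) =
      ∑ j, w j * (M.discount ^ n * ∑ s, stateDist M π n s * M.feat s j) := fun n => by
    simp only [dotProduct, Finset.mul_sum]
    rw [Finset.sum_comm]
    exact Finset.sum_congr rfl fun j _ => Finset.sum_congr rfl fun s _ => by ring
  unfold value discountedSum
  simp only [hterm]
  rw [Summable.tsum_finsetSum fun j _ => (summable_discounted_feat M π j).mul_left (w j)]
  simp only [tsum_mul_left]
  rfl

theorem continuous_featureExp : Continuous (featureExp M) := by
  refine continuous_pi fun j => continuous_tsum (u := fun n => M.discount ^ n) (fun n => ?_)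
    (summable_geometric_of_lt_one M.discount_nonneg M.discount_lt_one) fun n π => ?_
  · exact continuous_const.mul (continuous_finsetSum _ fun s _ =>
      (continuous_stateDist M n s).mul continuous_const)
  · have h := discounted_feat_mem_Icc M π j n
    rw [Real.norm_of_nonneg h.1]
    exact h.2

theorem isCompact_featurePolytope : IsCompact (featurePolytope M) :=
  isCompact_range (continuous_featureExp M)

end FeatureExpectations

theorem exists_isMaxminValue {k : ℕ} {K P : Set (Vec k)} (hK : IsCompact K) (hKne : K.Nonempty)
    (hP : IsCompact P) (hPne : P.Nonempty) : ∃ v, IsMaxminValue K P v := by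
  have hdot : Continuous fun z : Vec k × Vec k => z.1 ⬝ᵥ z.2 := by unfold dotProduct; fun_prop
  have hcont : Continuous fun μ : Vec k => sInf ((fun w => μ ⬝ᵥ w) '' P) :=
    hP.continuous_sInf hdot
  have hleast : ∀ μ : Vec k, IsLeast ((fun w => μ ⬝ᵥ w) '' P) (sInf ((fun w => μ ⬝ᵥ w) '' P)) :=
    fun μ => (hP.image (by unfold dotProduct; fun_prop)).isLeast_sInf (hPne.image _)
  obtain ⟨μ, hμ, hmax⟩ := hK.exists_isMaxOn hKne hcont.continuousOn
  refine ⟨_, ⟨μ, hμ, hleast μ⟩, ?_⟩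
  rintro m ⟨μ', hμ', hm⟩
  rw [hm.unique (hleast μ')]
  exact hmax hμ'

/-! ### Linear maximizers -/

/-- `F` selects, for every objective `v`, a maximizer of `x ⬝ v` over `x ∈ K`. -/
structure IsLinearMaximizer {k : ℕ} (K : Set (Vec k)) (F : Vec k → Vec k) : Prop where
  mem : ∀ v, F v ∈ K
  le : ∀ v, ∀ x ∈ K, x ⬝ᵥ v ≤ F v ⬝ᵥ v

theorem abs_dotProduct_le {k : ℕ} (x v : Vec k) : |x ⬝ᵥ v| ≤ (∑ j, |x j|) * ‖v‖ := by
  rw [Finset.sum_mul]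
  refine (Finset.abs_sum_le_sum_abs _ _).trans (Finset.sum_le_sum fun j _ => ?_)
  rw [abs_mul]
  exact mul_le_mul_of_nonneg_left (norm_le_pi_norm v j) (abs_nonneg _)

section LinearMaximizer

variable {k : ℕ} {K : Set (Vec k)} {F : Vec k → Vec k}

theorem IsLinearMaximizer.lipschitz (hF : IsLinearMaximizer K F) {B : ℝ}
    (hB : ∀ x ∈ K, ∑ j, |x j| ≤ B) :
    LipschitzWith B.toNNReal fun v => F v ⬝ᵥ v := by
  refine LipschitzWith.of_le_add_mul' B fun x y => ?_
  have h1 := hF.le y (F x) (hF.mem x)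
  have h2 : F x ⬝ᵥ (x - y) ≤ B * dist x y := by
    rw [dist_eq_norm]
    exact (le_abs_self _).trans ((abs_dotProduct_le _ _).trans
      (mul_le_mul_of_nonneg_right (hB _ (hF.mem x)) (norm_nonneg _)))
  rw [dotProduct_sub] at h2
  linarith

/-- A selection of maximizers over a bounded set is measurable up to a null set, however ties are
broken: the support function `v ↦ F v ⬝ v` is Lipschitz, so by Rademacher's theorem it is
differentiable almost everywhere, and there the maximizer is its gradient. -/
theorem IsLinearMaximizer.aemeasurable (hF : IsLinearMaximizer K F) {B : ℝ}
    (hB : ∀ x ∈ K, ∑ j, |x j| ≤ B) : AEMeasurable F volume := by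
  let h : Vec k → ℝ := fun v => F v ⬝ᵥ v
  refine ⟨fun v j => fderiv ℝ h v (Pi.single j 1),
    measurable_pi_lambda _ fun j => measurable_fderiv_apply_const ℝ h _, ?_⟩
  filter_upwards [(hF.lipschitz hB).ae_differentiableAt (μ := volume)] with v hv
  let l : Vec k →L[ℝ] ℝ := LinearMap.toContinuousLinearMap
    { toFun := fun x => F v ⬝ᵥ x
      map_add' := fun x y => dotProduct_add _ x y
      map_smul' := fun r x => dotProduct_smul r _ x }
  have hmin : IsLocalMin (fun x => h x - l x) v := Filter.Eventually.of_forall fun x => by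
    have h1 : F v ⬝ᵥ x ≤ F x ⬝ᵥ x := hF.le x (F v) (hF.mem v)
    change F v ⬝ᵥ v - F v ⬝ᵥ v ≤ F x ⬝ᵥ x - F v ⬝ᵥ x
    linarith
  have h0 := hmin.fderiv_eq_zero
  have hsub : fderiv ℝ (fun x => h x - l x) v = fderiv ℝ h v - l := by
    rw [fderiv_fun_sub hv l.differentiableAt, ContinuousLinearMap.fderiv]
  rw [hsub, sub_eq_zero] at h0
  funext j
  rw [h0]
  exact (dotProduct_single_one (F v) j).symm

end LinearMaximizer

/-! ### Uniform noise on a cube -/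

theorem one_sub_sum_le_prod_one_sub {ι : Type*} (s : Finset ι) (x : ι → ℝ)
    (h0 : ∀ i ∈ s, 0 ≤ x i) (h1 : ∀ i ∈ s, x i ≤ 1) :
    1 - ∑ i ∈ s, x i ≤ ∏ i ∈ s, (1 - x i) := by
  classical
  induction s using Finset.induction_on with
  | empty => simp
  | insert a s ha ih =>
    rw [Finset.sum_insert ha, Finset.prod_insert ha]
    have hih := ih (fun i hi => h0 i (Finset.mem_insert_of_mem hi))
      (fun i hi => h1 i (Finset.mem_insert_of_mem hi))
    have ha0 := h0 a (Finset.mem_insert_self _ _)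
    have ha1 := h1 a (Finset.mem_insert_self _ _)
    have hs : 0 ≤ ∑ i ∈ s, x i :=
      Finset.sum_nonneg fun i hi => h0 i (Finset.mem_insert_of_mem hi)
    nlinarith [mul_le_mul_of_nonneg_left hih (sub_nonneg.2 ha1)]

section Cube

variable {k : ℕ} {c : ℝ}

/-- The cube `[0, c]^k`. -/
def cube (k : ℕ) (c : ℝ) : Set (Vec k) := Set.Icc 0 fun _ => c

theorem volume_real_cube (hc : 0 ≤ c) : volume.real (cube k c) = c ^ k := by
  rw [Measure.real, cube, Real.volume_Icc_pi_toReal (a := (0 : Vec k)) (b := fun _ => c) (fun _ => hc)]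
  simp

/-- The uniform distribution on the cube `[0, c]^k`. -/
def cubeMeasure (k : ℕ) (c : ℝ) : Measure (Vec k) := ProbabilityTheory.cond volume (cube k c)

theorem isProbabilityMeasure_cubeMeasure (hc : 0 < c) :
    IsProbabilityMeasure (cubeMeasure k c) := by
  refine cond_isProbabilityMeasure_of_finite (fun h => ?_) isCompact_Icc.measure_lt_top.ne
  have h1 := volume_real_cube (k := k) hc.le
  rw [Measure.real, h] at h1
  exact (pow_pos hc k).ne h1

theorem cubeMeasure_absolutelyContinuous : cubeMeasure k c ≪ volume := cond_absolutelyContinuous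

theorem ae_mem_cube : ∀ᵐ p ∂cubeMeasure k c, p ∈ cube k c := ae_cond_mem measurableSet_Icc

theorem integral_cubeMeasure (hc : 0 ≤ c) (f : Vec k → ℝ) :
    ∫ p, f p ∂cubeMeasure k c = (c ^ k)⁻¹ * ∫ p in cube k c, f p := by
  rw [cubeMeasure, ProbabilityTheory.cond, integral_smul_measure, ← volume_real_cube hc,
    ENNReal.toReal_inv, smul_eq_mul, Measure.real]

theorem integrable_cubeMeasure_of_continuous (hc : 0 < c) {f : Vec k → ℝ} (hf : Continuous f) :
    Integrable f (cubeMeasure k c) := by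
  refine Integrable.smul_measure (hf.integrableOn_Icc) ?_
  have h1 := volume_real_cube (k := k) hc.le
  refine ENNReal.inv_ne_top.2 fun h => ?_
  rw [Measure.real, h] at h1
  exact (pow_pos hc k).ne h1

/-- Two cubes of side `c` that differ by the translation `w` overlap in all but the fraction
`‖w‖₁ / c` of their volume. -/
theorem le_volume_real_inter_cube (hc : 0 < c) {w : Vec k} (hw : ∀ j, |w j| ≤ c) :
    c ^ k * (1 - (∑ j, |w j|) / c) ≤
      volume.real (cube k c ∩ Set.Icc w (w + fun _ => c)) := by
  rw [cube, Set.Icc_inter_Icc, Measure.real, Real.volume_Icc_pi_toReal]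
  · have hside : ∀ j, ((fun _ => c) ⊓ (w + fun _ => c)) j - ((0 : Vec k) ⊔ w) j =
        c * (1 - |w j| / c) := fun j => by
      simp only [Pi.inf_apply, Pi.sup_apply, Pi.add_apply, Pi.zero_apply]
      rw [mul_sub, mul_div_cancel₀ _ hc.ne', mul_one]
      rcases le_total 0 (w j) with h | h
      · rw [abs_of_nonneg h, max_eq_right h, min_eq_left (by linarith)]
      · rw [abs_of_nonpos h, max_eq_left h, min_eq_right (by linarith)]; ring
    rw [Finset.prod_congr rfl fun j _ => hside j, Finset.prod_mul_distrib, Finset.prod_const,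
      Finset.card_univ, Fintype.card_fin, Finset.sum_div]
    refine mul_le_mul_of_nonneg_left ?_ (pow_nonneg hc.le k)
    exact one_sub_sum_le_prod_one_sub _ _ (fun j _ => div_nonneg (abs_nonneg _) hc.le)
      fun j _ => (div_le_one hc).2 (hw j)
  · intro j
    have := abs_le.1 (hw j)
    simp only [Pi.inf_apply, Pi.sup_apply, Pi.add_apply, Pi.zero_apply]
    exact le_min (max_le hc.le this.2) (max_le (by linarith) (by linarith))

/-- Translating the noise by `w` changes the mean of a function bounded by `B` by at most
`2 B ‖w‖₁ / c`. -/
theorem integral_cubeMeasure_translate_sub_le (hc : 0 < c) {w : Vec k} (hw : ∀ j, |w j| ≤ c)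
    {B : ℝ} {f : Vec k → ℝ} (hf : AEMeasurable f volume) (hfB : ∀ x, |f x| ≤ B) :
    ∫ p, f (p + w) ∂cubeMeasure k c - ∫ p, f p ∂cubeMeasure k c ≤
      2 * B * (∑ j, |w j|) / c := by
  have hshift : ∫ p in cube k c, f (p + w) = ∫ p in Set.Icc w (w + fun _ => c), f p := by
    rw [← (measurePreserving_add_right volume w).setIntegral_preimage_emb
      (measurableEmbedding_addRight w) f (Set.Icc w (w + fun _ => c))]
    congr 2
    ext p
    simp only [cube, Set.mem_preimage, Set.mem_Icc, le_add_iff_nonneg_left]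
    rw [add_comm p w, add_le_add_iff_left]
  set C := cube k c with hC
  set D := Set.Icc w (w + fun _ => c) with hD
  have hB0 : 0 ≤ B := (abs_nonneg _).trans (hfB 0)
  have hCfin : volume C < ⊤ := isCompact_Icc.measure_lt_top
  have hDfin : volume D < ⊤ := isCompact_Icc.measure_lt_top
  have hint : ∀ U : Set (Vec k), volume U < ⊤ → IntegrableOn f U := fun U hU =>
    Measure.integrableOn_of_bounded hU.ne hf.aestronglyMeasurable (M := B)
      (Filter.Eventually.of_forall hfB)
  have hI : MeasurableSet (C ∩ D) := measurableSet_Icc.inter measurableSet_Icc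
  have hpart : ∀ U : Set (Vec k), volume U < ⊤ → C ∩ D ⊆ U → volume.real U = c ^ k →
      |(∫ p in U, f p) - ∫ p in C ∩ D, f p| ≤ B * (c ^ k * ((∑ j, |w j|) / c)) :=
    fun U hU hsub hvol => by
    rw [← setIntegral_sdiff hI (hint U hU) hsub]
    have h1 := norm_setIntegral_le_of_norm_le_const (μ := volume) (s := U \ (C ∩ D)) (f := f)
      ((measure_mono Set.sdiff_subset).trans_lt hU) (fun x _ => hfB x)
    refine h1.trans (mul_le_mul_of_nonneg_left ?_ hB0)
    rw [measureReal_sdiff hsub hI hU.ne, hvol]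
    have := le_volume_real_inter_cube hc hw
    linarith
  have h1 := abs_le.1 (hpart C hCfin Set.inter_subset_left (volume_real_cube hc.le))
  have h2 := abs_le.1 (hpart D hDfin Set.inter_subset_right (by
    rw [hD, Measure.real, Real.volume_Icc_pi_toReal (fun j => by simp [hc.le])]
    simp))
  rw [integral_cubeMeasure hc.le, integral_cubeMeasure hc.le, ← hC, hshift, ← mul_sub,
    inv_mul_le_iff₀ (pow_pos hc k)]
  calc _ ≤ 2 * (B * (c ^ k * ((∑ j, |w j|) / c))) := by linarith
    _ = _ := by ring

end Cube

/-! ### The smoothed support function -/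

section Smoothed

variable {k : ℕ} {c : ℝ} {K : Set (Vec k)} {F : Vec k → Vec k}

/-- The support function `v ↦ F v ⬝ v` of `K`, averaged over a perturbation of its argument by
uniform noise on `[0, c]^k`. -/
def smoothedSupport (c : ℝ) (F : Vec k → Vec k) (W : Vec k) : ℝ :=
  ∫ p, F (W + p) ⬝ᵥ (W + p) ∂cubeMeasure k c

theorem aemeasurable_comp_add {α : Type*} [MeasurableSpace α] {f : Vec k → α}
    (hf : AEMeasurable f volume) (W : Vec k) :
    AEMeasurable (fun p => f (W + p)) volume :=
  hf.comp_quasiMeasurePreserving (measurePreserving_add_left volume W).quasiMeasurePreserving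

theorem aemeasurable_dotProduct_const {α : Type*} [MeasurableSpace α] {μ : Measure α}
    {f : α → Vec k} (hf : AEMeasurable f μ) (w : Vec k) :
    AEMeasurable (fun x => f x ⬝ᵥ w) μ :=
  (show Measurable fun y : Vec k => y ⬝ᵥ w by unfold dotProduct; fun_prop).comp_aemeasurable hf

theorem integrable_of_abs_le {α : Type*} [MeasurableSpace α] {μ : Measure α} [IsFiniteMeasure μ]
    {f : α → ℝ} (hf : AEMeasurable f μ) {B : ℝ} (hB : ∀ x, |f x| ≤ B) : Integrable f μ :=
  Integrable.of_bound hf.aestronglyMeasurable B (Filter.Eventually.of_forall hB)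

namespace IsLinearMaximizer

variable {B : ℝ} (hF : IsLinearMaximizer K F) (hB : ∀ x ∈ K, ∑ j, |x j| ≤ B)

include hF hB

theorem integrable_support (hc : 0 < c) (W : Vec k) :
    Integrable (fun p => F (W + p) ⬝ᵥ (W + p)) (cubeMeasure k c) :=
  integrable_cubeMeasure_of_continuous hc
    ((hF.lipschitz hB).continuous.comp (continuous_const.add continuous_id))

theorem integrable_dotProduct (hc : 0 < c) (W w : Vec k) :
    Integrable (fun p => F (W + p) ⬝ᵥ w) (cubeMeasure k c) := by
  have := isProbabilityMeasure_cubeMeasure (k := k) hc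
  exact integrable_of_abs_le (aemeasurable_dotProduct_const
    ((aemeasurable_comp_add (hF.aemeasurable hB) W).mono_ac cubeMeasure_absolutelyContinuous) w)
    (B := B * ‖w‖) fun p => (abs_dotProduct_le _ _).trans
      (mul_le_mul_of_nonneg_right (hB _ (hF.mem _)) (norm_nonneg _))

theorem continuous_smoothedSupport (hc : 0 < c) : Continuous (smoothedSupport c F) := by
  have := isProbabilityMeasure_cubeMeasure (k := k) hc
  refine (LipschitzWith.of_le_add_mul B.toNNReal fun x y => ?_).continuous
  calc smoothedSupport c F x
      ≤ ∫ p, (F (y + p) ⬝ᵥ (y + p) + B.toNNReal * dist x y) ∂cubeMeasure k c := by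
        refine integral_mono (hF.integrable_support hB hc x)
          ((hF.integrable_support hB hc y).add (integrable_const _)) fun p => ?_
        have := (hF.lipschitz hB).dist_le_mul (x + p) (y + p)
        rw [dist_add_right, Real.dist_eq] at this
        have := (abs_le.1 this).2
        simp only at this ⊢
        linarith
    _ = _ := by
        rw [integral_add (hF.integrable_support hB hc y) (integrable_const _)]
        simp [smoothedSupport]

/-- One step of be-the-leader followed by stability: moving the argument by `w` raises the
smoothed support function by at most the gain `F (W + p) ⬝ w` expected before the move, plus the
cost of the non-overlapping parts of the two noise cubes. -/
theorem smoothedSupport_add_sub_le (hc : 0 < c) (W : Vec k) {w : Vec k} (hw : ∀ j, |w j| ≤ c)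
    {D : ℝ} (hD : ∀ x ∈ K, |x ⬝ᵥ w| ≤ D) :
    smoothedSupport c F (W + w) - smoothedSupport c F W ≤
      ∫ p, F (W + p) ⬝ᵥ w ∂cubeMeasure k c + 2 * D * (∑ j, |w j|) / c := by
  have h1 : smoothedSupport c F (W + w) - smoothedSupport c F W ≤
      ∫ p, F ((W + w) + p) ⬝ᵥ w ∂cubeMeasure k c := by
    unfold smoothedSupport
    rw [← integral_sub (hF.integrable_support hB hc _) (hF.integrable_support hB hc _)]
    refine integral_mono ((hF.integrable_support hB hc _).sub (hF.integrable_support hB hc _))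
      (hF.integrable_dotProduct hB hc _ _) fun p => ?_
    have := hF.le (W + p) (F ((W + w) + p)) (hF.mem _)
    have hsplit : F ((W + w) + p) ⬝ᵥ ((W + w) + p) =
        F ((W + w) + p) ⬝ᵥ (W + p) + F ((W + w) + p) ⬝ᵥ w := by
      rw [← dotProduct_add]; congr 1; abel
    simp only
    linarith
  have h2 := integral_cubeMeasure_translate_sub_le hc hw
    (f := fun p => F (W + p) ⬝ᵥ w) (B := D)
    (aemeasurable_dotProduct_const (aemeasurable_comp_add (hF.aemeasurable hB) W) w)
    (fun p => hD _ (hF.mem _))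
  have h3 : ∀ p, W + w + p = W + (p + w) := fun p => by abel
  simp only [h3] at h1
  linarith

theorem smoothedSupport_zero_le (hc : 0 < c) : smoothedSupport c F 0 ≤ B * c := by
  have := isProbabilityMeasure_cubeMeasure (k := k) hc
  have hle : ∀ᵐ p ∂cubeMeasure k c, F (0 + p) ⬝ᵥ (0 + p) ≤ B * c := by
    filter_upwards [ae_mem_cube] with p hp
    rw [zero_add]
    have hnorm : ‖p‖ ≤ c := (pi_norm_le_iff_of_nonneg hc.le).2 fun j => by
      rw [Real.norm_of_nonneg (hp.1 j)]; exact hp.2 j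
    have hB0 : 0 ≤ B := (Finset.sum_nonneg fun j _ => abs_nonneg _).trans (hB _ (hF.mem p))
    exact (le_abs_self _).trans ((abs_dotProduct_le _ _).trans
      (mul_le_mul (hB _ (hF.mem p)) hnorm (norm_nonneg _) hB0))
  refine (integral_mono_ae (hF.integrable_support hB hc 0) (integrable_const _) hle).trans ?_
  simp

theorem sub_le_smoothedSupport (hc : 0 < c) (W : Vec k) {x : Vec k} (hx : x ∈ K) {r : ℝ}
    (hr : ∀ p ∈ cube k c, -r ≤ x ⬝ᵥ p) : x ⬝ᵥ W - r ≤ smoothedSupport c F W := by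
  have := isProbabilityMeasure_cubeMeasure (k := k) hc
  have hle : ∀ᵐ p ∂cubeMeasure k c, x ⬝ᵥ W - r ≤ F (W + p) ⬝ᵥ (W + p) := by
    filter_upwards [ae_mem_cube] with p hp
    have h1 := hF.le (W + p) x hx
    rw [dotProduct_add] at h1
    linarith [hr p hp]
  refine le_trans ?_
    (integral_mono_ae (integrable_const _) (hF.integrable_support hB hc W) hle)
  simp

theorem integral_dotProduct (hc : 0 < c) (W w : Vec k) :
    ∫ p, F (W + p) ⬝ᵥ w ∂cubeMeasure k c =
      (fun j => ∫ p, F (W + p) j ∂cubeMeasure k c) ⬝ᵥ w := by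
  have hint : ∀ j, Integrable (fun p => F (W + p) j) (cubeMeasure k c) := fun j => by
    simpa using hF.integrable_dotProduct hB hc W (Pi.single j 1)
  simp only [dotProduct]
  rw [integral_finsetSum _ fun j _ => (hint j).mul_const _]
  simp only [integral_mul_const]

end IsLinearMaximizer

end Smoothed

/-! ### The dynamics of the accumulated weights and features -/

section Dynamics

variable {k : ℕ} {c : ℝ}

/-- One round on the state `(W, M)` of accumulated weights and features, with noise
`z = (p, q)`: the responses are `F (W + p)` and `G (M + q)`. -/
def fplStep (F G : Vec k → Vec k) (x z : Vec k × Vec k) : Vec k × Vec k :=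
  (x.1 + G (x.2 + z.2), x.2 + F (x.1 + z.1))

/-- The state after `n` rounds, started from `(0, 0)`, as a function of the noise. -/
def fplState (F G : Vec k → Vec k) : (n : ℕ) → (Fin n → Vec k × Vec k) → Vec k × Vec k
  | 0, _ => 0
  | n + 1, z => fplStep F G (fplState F G n fun t => z t.castSucc) (z (Fin.last n))

/-- The joint law of the two perturbations of one round. -/
def noise (k : ℕ) (c : ℝ) : Measure (Vec k × Vec k) := (cubeMeasure k c).prod (cubeMeasure k c)

theorem isProbabilityMeasure_noise (hc : 0 < c) : IsProbabilityMeasure (noise k c) := by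
  have := isProbabilityMeasure_cubeMeasure (k := k) hc
  unfold noise
  infer_instance

/-- The response is evaluated at a point shifted by fresh noise with a density, so the null set on
which `F` is ill-behaved is hit with probability zero. -/
theorem aemeasurable_response (hc : 0 < c) {Ω : Type*} [MeasurableSpace Ω] {P : Measure Ω}
    [SFinite P] {X : Ω → Vec k} (hX : AEMeasurable X P) {F : Vec k → Vec k}
    (hF : AEMeasurable F volume) :
    AEMeasurable (fun z : Vec k × Ω => F (X z.2 + z.1)) ((cubeMeasure k c).prod P) := by
  have := isProbabilityMeasure_cubeMeasure (k := k) hc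
  let f : Vec k × Ω → Vec k := fun z => hX.mk X z.2 + z.1
  have hqmp : Measure.QuasiMeasurePreserving f ((cubeMeasure k c).prod P) volume := by
    refine QuasiMeasurePreserving.prod_of_left
      ((hX.measurable_mk.comp measurable_snd).add measurable_fst)
      (Filter.Eventually.of_forall fun ω => ?_)
    exact (measurePreserving_add_left volume (hX.mk X ω)).quasiMeasurePreserving.mono_left
      cubeMeasure_absolutelyContinuous
  refine (hF.comp_quasiMeasurePreserving hqmp).congr ?_
  have hae : ∀ᵐ z ∂(cubeMeasure k c).prod P, X z.2 = hX.mk X z.2 :=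
    Measure.quasiMeasurePreserving_snd.ae hX.ae_eq_mk
  filter_upwards [hae] with z hz
  simp [f, hz]

theorem aemeasurable_fplStep (hc : 0 < c) {Ω : Type*} [MeasurableSpace Ω] {P : Measure Ω}
    [SFinite P] {X : Ω → Vec k × Vec k} (hX : AEMeasurable X P) {F G : Vec k → Vec k}
    (hF : AEMeasurable F volume) (hG : AEMeasurable G volume) :
    AEMeasurable (fun z : (Vec k × Vec k) × Ω => fplStep F G (X z.2) z.1)
      ((noise k c).prod P) := by
  have := isProbabilityMeasure_cubeMeasure (k := k) hc
  have := isProbabilityMeasure_noise (k := k) hc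
  have hsnd : AEMeasurable (fun z : (Vec k × Vec k) × Ω => X z.2) ((noise k c).prod P) :=
    hX.comp_quasiMeasurePreserving Measure.quasiMeasurePreserving_snd
  have h1 : MeasurePreserving (fun z : (Vec k × Vec k) × Ω => (z.1.1, z.2))
      ((noise k c).prod P) ((cubeMeasure k c).prod P) :=
    (measurePreserving_fst (μ := cubeMeasure k c) (ν := cubeMeasure k c)).prod
      (MeasurePreserving.id P)
  have h2 : MeasurePreserving (fun z : (Vec k × Vec k) × Ω => (z.1.2, z.2))
      ((noise k c).prod P) ((cubeMeasure k c).prod P) :=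
    (measurePreserving_snd (μ := cubeMeasure k c) (ν := cubeMeasure k c)).prod
      (MeasurePreserving.id P)
  have hF' := (aemeasurable_response hc hX.fst hF).comp_quasiMeasurePreserving
    h1.quasiMeasurePreserving
  have hG' := (aemeasurable_response hc hX.snd hG).comp_quasiMeasurePreserving
    h2.quasiMeasurePreserving
  exact (hsnd.fst.add hG').prodMk (hsnd.snd.add hF')

theorem measurePreserving_last_init (hc : 0 < c) (n : ℕ) :
    MeasurePreserving (fun z : Fin (n + 1) → Vec k × Vec k =>
        (z (Fin.last n), fun t : Fin n => z t.castSucc))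
      (Measure.pi fun _ => noise k c) ((noise k c).prod (Measure.pi fun _ => noise k c)) := by
  have := isProbabilityMeasure_noise (k := k) hc
  have h := measurePreserving_piFinSuccAbove (fun _ : Fin (n + 1) => noise k c) (Fin.last n)
  convert h using 1
  ext z
  all_goals simp [MeasurableEquiv.piFinSuccAbove, Fin.init]

theorem aemeasurable_fplState (hc : 0 < c) {F G : Vec k → Vec k}
    (hF : AEMeasurable F volume) (hG : AEMeasurable G volume) (n : ℕ) :
    AEMeasurable (fplState F G n) (Measure.pi fun _ => noise k c) := by
  have := isProbabilityMeasure_noise (k := k) hc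
  induction n with
  | zero => exact measurable_const.aemeasurable
  | succ n ih =>
    exact (aemeasurable_fplStep hc ih hF hG).comp_quasiMeasurePreserving
      (measurePreserving_last_init hc n).quasiMeasurePreserving

theorem dotProduct_fplState_fst_ge {F G : Vec k → Vec k} {x : Vec k} {v : ℝ}
    (hx : ∀ u, v ≤ x ⬝ᵥ G u) (n : ℕ) (z : Fin n → Vec k × Vec k) :
    n * v ≤ x ⬝ᵥ (fplState F G n z).1 := by
  induction n with
  | zero => simp [fplState]
  | succ n ih =>
    rw [fplState, fplStep, dotProduct_add]
    push_cast
    linarith [ih fun t => z t.castSucc, hx ((fplState F G n fun t => z t.castSucc).2 +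
      (z (Fin.last n)).2)]

end Dynamics

/-! ### Exponential moments of the potential -/

/-- The standing assumptions on the responses `F` (features) and `G` (weights) of the two players:
both are optimal, features are bounded in `ℓ¹` and weights in `ℓ^∞`. -/
structure IsGame {k : ℕ} (K P : Set (Vec k)) (F G : Vec k → Vec k) : Prop where
  maxF : IsLinearMaximizer K F
  maxG : IsLinearMaximizer (-P) fun v => -G v
  sum_le : ∀ x ∈ K, ∑ j, |x j| ≤ k
  abs_weight_le : ∀ w ∈ P, ∀ j, |w j| ≤ 1

section Potential

variable {k : ℕ} {c : ℝ} {K P : Set (Vec k)} {F G : Vec k → Vec k}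

/-- The potential of the state `(W, M)`: the sum of the smoothed support functions of `K` at `W`
and of `-P` at `M`. -/
def potential (c : ℝ) (F G : Vec k → Vec k) (x : Vec k × Vec k) : ℝ :=
  smoothedSupport c F x.1 + smoothedSupport c (fun v => -G v) x.2

namespace IsGame

theorem sum_le_weights (h : IsGame K P F G) : ∀ x ∈ -P, ∑ j, |x j| ≤ k := fun x hx => by
  calc ∑ j, |x j| ≤ ∑ _j : Fin k, (1 : ℝ) := Finset.sum_le_sum fun j _ => by
        simpa using h.abs_weight_le _ hx j
    _ = k := by simp

theorem abs_payoff_le (h : IsGame K P F G) {x w : Vec k} (hx : x ∈ K) (hw : w ∈ P) :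
    |x ⬝ᵥ w| ≤ k := by
  refine (abs_dotProduct_le x w).trans ?_
  have h1 : ‖w‖ ≤ 1 := (pi_norm_le_iff_of_nonneg zero_le_one).2 fun j => h.abs_weight_le w hw j
  calc (∑ j, |x j|) * ‖w‖ ≤ k * 1 :=
        mul_le_mul (h.sum_le x hx) h1 (norm_nonneg _) (Nat.cast_nonneg k)
    _ = k := mul_one _

theorem memG (h : IsGame K P F G) (v : Vec k) : G v ∈ P := by simpa using h.maxG.mem v

theorem aemeasurableF (h : IsGame K P F G) : AEMeasurable F volume :=
  h.maxF.aemeasurable h.sum_le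

theorem aemeasurableG (h : IsGame K P F G) : AEMeasurable G volume := by
  simpa [Function.comp_def] using measurable_neg.comp_aemeasurable (h.maxG.aemeasurable h.sum_le_weights)

theorem continuous_potential (h : IsGame K P F G) (hc : 0 < c) :
    Continuous (potential c F G) :=
  ((h.maxF.continuous_smoothedSupport h.sum_le hc).comp continuous_fst).add
    ((h.maxG.continuous_smoothedSupport h.sum_le_weights hc).comp continuous_snd)

/-- An upper bound, up to the stability cost, for the increase of the potential in one round: each
player's mean response is paired with the actual response of the opponent. -/
def drift (c : ℝ) (F G : Vec k → Vec k) (x z : Vec k × Vec k) : ℝ :=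
  (∫ p, F (x.1 + p) ⬝ᵥ G (x.2 + z.2) ∂cubeMeasure k c) +
    ∫ q, -G (x.2 + q) ⬝ᵥ F (x.1 + z.1) ∂cubeMeasure k c

theorem potential_fplStep_le (h : IsGame K P F G) (hkc : k ≤ c) (hc : 1 ≤ c)
    (x z : Vec k × Vec k) :
    potential c F G (fplStep F G x z) ≤
      potential c F G x + drift c F G x z + 4 * k ^ 2 / c := by
  have hc0 : 0 < c := zero_lt_one.trans_le hc
  have hG := h.memG (x.2 + z.2)
  have hFm := h.maxF.mem (x.1 + z.1)
  have h1 := h.maxF.smoothedSupport_add_sub_le h.sum_le hc0 x.1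
    (w := G (x.2 + z.2)) (fun j => (h.abs_weight_le _ hG j).trans hc)
    (D := k) fun y hy => h.abs_payoff_le hy hG
  have h2 := h.maxG.smoothedSupport_add_sub_le h.sum_le_weights hc0 x.2
    (w := F (x.1 + z.1)) (fun j => (Finset.single_le_sum (f := fun j => |F (x.1 + z.1) j|)
      (fun j _ => abs_nonneg _) (Finset.mem_univ j)).trans ((h.sum_le _ hFm).trans hkc))
    (D := k) fun y hy => by
      have := h.abs_payoff_le hFm hy
      rwa [dotProduct_neg, abs_neg, dotProduct_comm] at this
  have hcost : ∀ w : Vec k, ∑ j, |w j| ≤ k → 2 * (k : ℝ) * (∑ j, |w j|) / c ≤ 2 * k ^ 2 / c :=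
    fun w hw => by
      refine div_le_div_of_nonneg_right ?_ hc0.le
      nlinarith [mul_le_mul_of_nonneg_left hw (Nat.cast_nonneg (α := ℝ) k)]
  have h3 := hcost _ (by simpa using h.sum_le_weights (-G (x.2 + z.2)) (by simpa using hG))
  have h4 := hcost _ (h.sum_le _ hFm)
  have h5 : 4 * (k : ℝ) ^ 2 / c = 2 * k ^ 2 / c + 2 * k ^ 2 / c := by ring
  unfold potential drift fplStep
  simp only
  linarith

theorem abs_drift_le (h : IsGame K P F G) (hc : 0 < c) (x z : Vec k × Vec k) :
    |drift c F G x z| ≤ 2 * k := by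
  have := isProbabilityMeasure_cubeMeasure (k := k) hc
  have hI : ∀ f : Vec k → ℝ, (∀ p, |f p| ≤ k) → |∫ p, f p ∂cubeMeasure k c| ≤ k := fun f hf => by
    simpa using norm_integral_le_of_norm_le_const (μ := cubeMeasure k c) (f := f) (C := k)
      (Filter.Eventually.of_forall hf)
  have h1 := hI (fun p => F (x.1 + p) ⬝ᵥ G (x.2 + z.2)) fun p =>
    h.abs_payoff_le (h.maxF.mem _) (h.memG _)
  have h2 := hI (fun q => -G (x.2 + q) ⬝ᵥ F (x.1 + z.1)) fun q => by
    rw [neg_dotProduct, abs_neg, dotProduct_comm]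
    exact h.abs_payoff_le (h.maxF.mem _) (h.memG _)
  refine (abs_add_le _ _).trans ?_
  linarith

/-- The gains of the two players cancel in the mean, because the game has sum zero and the two
perturbations of a round are independent. -/
theorem integral_drift (h : IsGame K P F G) (hc : 0 < c) (x : Vec k × Vec k) :
    AEMeasurable (drift c F G x) (noise k c) ∧ ∫ z, drift c F G x z ∂noise k c = 0 := by
  have := isProbabilityMeasure_cubeMeasure (k := k) hc
  set f : Vec k := fun j => ∫ p, F (x.1 + p) j ∂cubeMeasure k c with hf
  set g : Vec k := fun j => ∫ q, (-G (x.2 + q)) j ∂cubeMeasure k c with hg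
  have hdrift : drift c F G x = fun z => f ⬝ᵥ G (x.2 + z.2) + g ⬝ᵥ F (x.1 + z.1) :=
    funext fun z => by
      unfold drift
      rw [h.maxF.integral_dotProduct h.sum_le hc,
        h.maxG.integral_dotProduct h.sum_le_weights hc]
  have hGint : Integrable (fun q => f ⬝ᵥ G (x.2 + q)) (cubeMeasure k c) := by
    have := (h.maxG.integrable_dotProduct h.sum_le_weights hc x.2 f).neg
    refine this.congr (Filter.Eventually.of_forall fun q => ?_)
    simp [dotProduct_comm f]
  have hFint : Integrable (fun p => g ⬝ᵥ F (x.1 + p)) (cubeMeasure k c) := by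
    refine (h.maxF.integrable_dotProduct h.sum_le hc x.1 g).congr
      (Filter.Eventually.of_forall fun q => ?_)
    simp [dotProduct_comm g]
  have hGval : ∫ q, f ⬝ᵥ G (x.2 + q) ∂cubeMeasure k c = -(g ⬝ᵥ f) := by
    rw [← h.maxG.integral_dotProduct h.sum_le_weights hc, ← integral_neg]
    exact integral_congr_ae (Filter.Eventually.of_forall fun q => by simp [dotProduct_comm f])
  have hFval : ∫ p, g ⬝ᵥ F (x.1 + p) ∂cubeMeasure k c = g ⬝ᵥ f := by
    rw [dotProduct_comm g f, ← h.maxF.integral_dotProduct h.sum_le hc]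
    exact integral_congr_ae (Filter.Eventually.of_forall fun q => by simp [dotProduct_comm g])
  have hG2 : Integrable (fun z : Vec k × Vec k => f ⬝ᵥ G (x.2 + z.2)) (noise k c) :=
    hGint.comp_snd _
  have hF2 : Integrable (fun z : Vec k × Vec k => g ⬝ᵥ F (x.1 + z.1)) (noise k c) :=
    hFint.comp_fst _
  rw [hdrift]
  refine ⟨hG2.aestronglyMeasurable.aemeasurable.add hF2.aestronglyMeasurable.aemeasurable, ?_⟩
  rw [integral_add hG2 hF2, noise, integral_fun_snd (fun q => f ⬝ᵥ G (x.2 + q)),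
    integral_fun_fst (fun p => g ⬝ᵥ F (x.1 + p)), hGval, hFval]
  simp

/-- One round multiplies the exponential moment of the potential by at most this factor, by
Hoeffding's lemma for the drift. -/
theorem lintegral_exp_fplStep_le (h : IsGame K P F G) (hkc : k ≤ c) (hc : 1 ≤ c) {l : ℝ}
    (hl : 0 ≤ l) (x : Vec k × Vec k) :
    ∫⁻ z, ENNReal.ofReal (Real.exp (l * potential c F G (fplStep F G x z))) ∂noise k c ≤
      ENNReal.ofReal (Real.exp (l * (4 * k ^ 2 / c) + 2 * k ^ 2 * l ^ 2)) *
        ENNReal.ofReal (Real.exp (l * potential c F G x)) := by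
  have hc0 : 0 < c := zero_lt_one.trans_le hc
  have := isProbabilityMeasure_noise (k := k) hc0
  obtain ⟨hmeas, hmean⟩ := h.integral_drift hc0 x
  have hsub := hasSubgaussianMGF_of_mem_Icc_of_integral_eq_zero hmeas
    (a := -(2 * (k : ℝ))) (b := 2 * k)
    (Filter.Eventually.of_forall fun z => abs_le.1 (h.abs_drift_le hc0 x z)) hmean
  have hmgf : ∫ z, Real.exp (l * drift c F G x z) ∂noise k c ≤
      Real.exp (2 * k ^ 2 * l ^ 2) := by
    refine (hsub.mgf_le l).trans (Real.exp_le_exp.2 (le_of_eq ?_))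
    have : ‖2 * (k : ℝ) - -(2 * k)‖ = 4 * k := by
      rw [sub_neg_eq_add, Real.norm_of_nonneg (by positivity)]; ring
    simp only [NNReal.coe_pow, NNReal.coe_div, coe_nnnorm, this, NNReal.coe_ofNat]
    ring
  set a := l * (4 * k ^ 2 / c) + l * potential c F G x with ha
  calc ∫⁻ z, ENNReal.ofReal (Real.exp (l * potential c F G (fplStep F G x z))) ∂noise k c
      ≤ ∫⁻ z, ENNReal.ofReal (Real.exp a * Real.exp (l * drift c F G x z)) ∂noise k c := by
        refine lintegral_mono fun z => ENNReal.ofReal_le_ofReal ?_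
        rw [← Real.exp_add]
        refine Real.exp_le_exp.2 ?_
        have := mul_le_mul_of_nonneg_left (h.potential_fplStep_le hkc hc x z) hl
        rw [ha]
        linarith
    _ = ENNReal.ofReal (∫ z, Real.exp a * Real.exp (l * drift c F G x z) ∂noise k c) := by
        rw [ofReal_integral_eq_lintegral_ofReal ((hsub.integrable_exp_mul l).const_mul _)
          (Filter.Eventually.of_forall fun z => by positivity)]
    _ ≤ ENNReal.ofReal (Real.exp a * Real.exp (2 * k ^ 2 * l ^ 2)) := by
        rw [integral_const_mul]
        exact ENNReal.ofReal_le_ofReal (mul_le_mul_of_nonneg_left hmgf (Real.exp_nonneg _))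
    _ = _ := by
        rw [← ENNReal.ofReal_mul (Real.exp_nonneg _), ← Real.exp_add, ← Real.exp_add, ha]
        ring_nf

theorem lintegral_exp_fplState_le (h : IsGame K P F G) (hkc : k ≤ c) (hc : 1 ≤ c) {l : ℝ}
    (hl : 0 ≤ l) (n : ℕ) :
    ∫⁻ z, ENNReal.ofReal (Real.exp (l * potential c F G (fplState F G n z)))
        ∂(Measure.pi fun _ => noise k c) ≤
      ENNReal.ofReal (Real.exp (l * potential c F G 0 +
        n * (l * (4 * k ^ 2 / c) + 2 * k ^ 2 * l ^ 2))) := by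
  have hc0 : 0 < c := zero_lt_one.trans_le hc
  have := isProbabilityMeasure_noise (k := k) hc0
  have hexp : Measurable fun x => ENNReal.ofReal (Real.exp (l * potential c F G x)) :=
    (Real.continuous_exp.comp
      (continuous_const.mul (h.continuous_potential hc0))).measurable.ennreal_ofReal
  induction n with
  | zero => simp [fplState]
  | succ n ih =>
    have hstep : AEMeasurable (fun z : (Vec k × Vec k) × (Fin n → Vec k × Vec k) =>
        ENNReal.ofReal (Real.exp (l * potential c F G (fplStep F G (fplState F G n z.2) z.1))))
        ((noise k c).prod (Measure.pi fun _ => noise k c)) :=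
      hexp.comp_aemeasurable (aemeasurable_fplStep hc0
        (aemeasurable_fplState hc0 h.aemeasurableF h.aemeasurableG n)
        h.aemeasurableF h.aemeasurableG)
    have hmp := measurePreserving_last_init (k := k) hc0 n
    calc ∫⁻ z, ENNReal.ofReal (Real.exp (l * potential c F G (fplState F G (n + 1) z)))
          ∂(Measure.pi fun _ => noise k c)
        = ∫⁻ z, ENNReal.ofReal (Real.exp
            (l * potential c F G (fplStep F G (fplState F G n z.2) z.1)))
            ∂((noise k c).prod (Measure.pi fun _ => noise k c)) := by
          rw [← hmp.map_eq, lintegral_map' (by rw [hmp.map_eq]; exact hstep) hmp.aemeasurable]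
          rfl
      _ = ∫⁻ y, ∫⁻ z, ENNReal.ofReal (Real.exp
            (l * potential c F G (fplStep F G (fplState F G n y) z))) ∂noise k c
            ∂(Measure.pi fun _ => noise k c) := lintegral_prod_symm _ hstep
      _ ≤ ∫⁻ y, ENNReal.ofReal (Real.exp (l * (4 * k ^ 2 / c) + 2 * k ^ 2 * l ^ 2)) *
            ENNReal.ofReal (Real.exp (l * potential c F G (fplState F G n y)))
            ∂(Measure.pi fun _ => noise k c) :=
          lintegral_mono fun y => h.lintegral_exp_fplStep_le hkc hc hl _
      _ = ENNReal.ofReal (Real.exp (l * (4 * k ^ 2 / c) + 2 * k ^ 2 * l ^ 2)) *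
            ∫⁻ y, ENNReal.ofReal (Real.exp (l * potential c F G (fplState F G n y)))
            ∂(Measure.pi fun _ => noise k c) :=
          lintegral_const_mul' _ _ ENNReal.ofReal_ne_top
      _ ≤ _ := mul_le_mul_right ih _
      _ = _ := by
          rw [← ENNReal.ofReal_mul (Real.exp_nonneg _), ← Real.exp_add]
          push_cast
          ring_nf

/-- Markov's inequality for the exponential moment. -/
theorem measure_le_potential_le (h : IsGame K P F G) (hkc : k ≤ c) (hc : 1 ≤ c) {l : ℝ}
    (hl : 0 ≤ l) (n : ℕ) (s : ℝ) :
    (Measure.pi fun _ => noise k c) {z | s ≤ potential c F G (fplState F G n z)} ≤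
      ENNReal.ofReal (Real.exp (l * (2 * k * c - s) +
        n * (l * (4 * k ^ 2 / c) + 2 * k ^ 2 * l ^ 2))) := by
  have hc0 : 0 < c := zero_lt_one.trans_le hc
  have h0 : potential c F G 0 ≤ 2 * k * c := by
    have h1 := h.maxF.smoothedSupport_zero_le h.sum_le hc0
    have h2 := h.maxG.smoothedSupport_zero_le h.sum_le_weights hc0
    unfold potential
    simp only [Prod.fst_zero, Prod.snd_zero]
    linarith
  have hmeas : AEMeasurable (fun z : Fin n → Vec k × Vec k =>
      ENNReal.ofReal (Real.exp (l * potential c F G (fplState F G n z))))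
      (Measure.pi fun _ => noise k c) :=
    ((Real.continuous_exp.comp (continuous_const.mul
      (h.continuous_potential hc0))).measurable.ennreal_ofReal).comp_aemeasurable
        (aemeasurable_fplState hc0 h.aemeasurableF h.aemeasurableG n)
  have hmarkov := mul_meas_ge_le_lintegral₀ hmeas (ENNReal.ofReal (Real.exp (l * s)))
  have hpos : ENNReal.ofReal (Real.exp (l * s)) ≠ 0 := by simp [Real.exp_pos]
  calc (Measure.pi fun _ => noise k c) {z | s ≤ potential c F G (fplState F G n z)}
      ≤ (Measure.pi fun _ => noise k c) {z | ENNReal.ofReal (Real.exp (l * s)) ≤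
          ENNReal.ofReal (Real.exp (l * potential c F G (fplState F G n z)))} :=
        measure_mono fun z hz => ENNReal.ofReal_le_ofReal
          (Real.exp_le_exp.2 (mul_le_mul_of_nonneg_left hz hl))
    _ ≤ (∫⁻ z, ENNReal.ofReal (Real.exp (l * potential c F G (fplState F G n z)))
          ∂(Measure.pi fun _ => noise k c)) / ENNReal.ofReal (Real.exp (l * s)) := by
        rw [ENNReal.le_div_iff_mul_le (Or.inl hpos) (Or.inl ENNReal.ofReal_ne_top), mul_comm]
        exact hmarkov
    _ ≤ ENNReal.ofReal (Real.exp (l * potential c F G 0 +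
          n * (l * (4 * k ^ 2 / c) + 2 * k ^ 2 * l ^ 2))) / ENNReal.ofReal (Real.exp (l * s)) :=
        ENNReal.div_le_div_right (h.lintegral_exp_fplState_le hkc hc hl n) _
    _ ≤ _ := by
        rw [← ENNReal.ofReal_div_of_pos (Real.exp_pos _), ← Real.exp_sub]
        refine ENNReal.ofReal_le_ofReal (Real.exp_le_exp.2 ?_)
        have := mul_le_mul_of_nonneg_left h0 hl
        linarith

/-- A small potential forces a good accumulated feature vector. Here `μ` is a maxmin strategy with
nonnegative features. -/
theorem le_dotProduct_snd (h : IsGame K P F G) (hc : 0 < c) {μ : Vec k} (hμ : μ ∈ K)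
    (hμ0 : ∀ j, 0 ≤ μ j) {v : ℝ} (hv : ∀ w ∈ P, v ≤ μ ⬝ᵥ w) (n : ℕ)
    (z : Fin n → Vec k × Vec k) {w : Vec k} (hw : w ∈ P) :
    n * v - potential c F G (fplState F G n z) - k * c ≤ w ⬝ᵥ (fplState F G n z).2 := by
  have h1 := h.maxF.sub_le_smoothedSupport h.sum_le hc (fplState F G n z).1 hμ (r := 0)
    fun p hp => by
      rw [neg_zero]
      exact Finset.sum_nonneg fun j _ => mul_nonneg (hμ0 j) (hp.1 j)
  have h2 := h.maxG.sub_le_smoothedSupport h.sum_le_weights hc (fplState F G n z).2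
    (x := -w) (by simpa using hw) (r := k * c) fun p hp => by
      have hnorm : ‖p‖ ≤ c := (pi_norm_le_iff_of_nonneg hc.le).2 fun j => by
        rw [Real.norm_of_nonneg (hp.1 j)]; exact hp.2 j
      exact (abs_le.1 ((abs_dotProduct_le (-w) p).trans
        (mul_le_mul (h.sum_le_weights _ (by simpa using hw)) hnorm (norm_nonneg _)
          (Nat.cast_nonneg k)))).1
  have h3 := dotProduct_fplState_fst_ge (F := F) (G := G) (fun u => hv _ (h.memG u)) n z
  rw [neg_dotProduct] at h2
  unfold potential
  linarith

end IsGame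

end Potential

/-! ### The high-probability guarantee -/

section Guarantee

variable {k : ℕ} {K P : Set (Vec k)} {F G : Vec k → Vec k}

/-- The exponent left after Markov's inequality. The potential bounds cost `3 k² √T + 4 k √T` in
total, which exceeds `6 k² √T` by one unit of `k √T` if `k = 1`; the excess is taken from the
deviation term, which leaves `(4 L - 1) k √T` for the deviation. The choice of `l` is the
optimal one for this deviation, with exponent `-(4 L - 1)² / 8`. -/
theorem tail_exponent_le {k T : ℕ} (hk : 0 < k) (hT : 0 < T) {L : ℝ} (hL : 1 / 4 ≤ L) {u l : ℝ}
    (hu : u = k * √(T : ℝ)) (hl : l = (4 * L - 1) / (4 * u)) :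
    l * (2 * k * u - k * u * (5 + 4 * L)) + T * (l * (4 * k ^ 2 / u) + 2 * k ^ 2 * l ^ 2) ≤
      Real.log 2 - L ^ 2 := by
  have hk1 : (1 : ℝ) ≤ k := by exact_mod_cast hk
  have hT0 : (0 : ℝ) < T := by exact_mod_cast hT
  have hu0 : 0 < u := by rw [hu]; positivity
  have hu2 : (T : ℝ) * k ^ 2 = u ^ 2 := by
    rw [hu, mul_pow, Real.sq_sqrt hT0.le]; ring
  have hlu : l * u = (4 * L - 1) / 4 := by rw [hl]; field_simp
  have e : l * (2 * k * u - k * u * (5 + 4 * L)) +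
      T * (l * (4 * k ^ 2 / u) + 2 * k ^ 2 * l ^ 2) =
      l * u * (4 - k * (3 + 4 * L)) + 2 * (l * u) ^ 2 := by
    have h1 : (T : ℝ) * (l * (4 * k ^ 2 / u)) = 4 * (l * u) := by
      rw [show (T : ℝ) * (l * (4 * k ^ 2 / u)) = 4 * (l * (T * k ^ 2 / u)) by ring, hu2]
      field_simp
    have h2 : (T : ℝ) * (2 * k ^ 2 * l ^ 2) = 2 * (l * u) ^ 2 := by
      rw [mul_pow, ← hu2]; ring
    rw [mul_add (T : ℝ), h1, h2]
    ring
  rw [e, hlu]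
  have h3 : (4 - k * (3 + 4 * L)) ≤ 1 - 4 * L := by nlinarith
  have h4 : (4 * L - 1) / 4 * (4 - k * (3 + 4 * L)) ≤ (4 * L - 1) / 4 * (1 - 4 * L) :=
    mul_le_mul_of_nonneg_left h3 (by linarith)
  have h5 := Real.log_two_gt_d9
  nlinarith [sq_nonneg (L - 1 / 2)]

theorem IsGame.le_measure_forall_le_dotProduct (h : IsGame K P F G) {T : ℕ} (hk : 0 < k)
    (hT : 0 < T) {μ : Vec k} (hμ : μ ∈ K) (hμ0 : ∀ j, 0 ≤ μ j) {v : ℝ}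
    (hv : ∀ w ∈ P, v ≤ μ ⬝ᵥ w) {ξ : ℝ} (hξ : 0 < ξ) (hξ2 : ξ < 1 / 2) :
    ENNReal.ofReal (1 - 2 * ξ) ≤ (Measure.pi fun _ => noise k (k * √(T : ℝ)))
      {z | ∀ w ∈ P, T * v - k ^ 2 * √(T : ℝ) * (6 + 4 * √(Real.log (1 / ξ))) ≤
        w ⬝ᵥ (fplState F G T z).2} := by
  set u := k * √(T : ℝ) with hu
  set L := √(Real.log (1 / ξ)) with hL
  have hk1 : (1 : ℝ) ≤ k := by exact_mod_cast hk
  have hT1 : (1 : ℝ) ≤ √(T : ℝ) := Real.one_le_sqrt.2 (by exact_mod_cast hT)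
  have hku : (k : ℝ) ≤ u := le_mul_of_one_le_right (by linarith) hT1
  have hu1 : 1 ≤ u := hk1.trans hku
  have hlog : Real.log 2 ≤ Real.log (1 / ξ) :=
    Real.log_le_log (by norm_num) ((le_div_iff₀ hξ).2 (by linarith))
  have hlog2 := Real.log_two_gt_d9
  have hLsq : L ^ 2 = Real.log (1 / ξ) := Real.sq_sqrt (by linarith)
  have hL4 : 1 / 4 ≤ L := Real.le_sqrt_of_sq_le (by linarith)
  have := isProbabilityMeasure_noise (k := k) (zero_lt_one.trans_le hu1)
  set E := {z : Fin T → Vec k × Vec k | ∀ w ∈ P,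
    T * v - k ^ 2 * √(T : ℝ) * (6 + 4 * L) ≤ w ⬝ᵥ (fplState F G T z).2} with hE
  set l := (4 * L - 1) / (4 * u) with hl
  have hl0 : 0 ≤ l := div_nonneg (by linarith) (by linarith)
  have hbad : Eᶜ ⊆ {z | k * u * (5 + 4 * L) ≤ potential u F G (fplState F G T z)} := by
    intro z hz
    simp only [hE, Set.mem_compl_iff, Set.mem_ofPred_eq, not_forall, not_le] at hz
    obtain ⟨w, hw, hlt⟩ := hz
    have h1 := h.le_dotProduct_snd (zero_lt_one.trans_le hu1) hμ hμ0 hv T z hw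
    have h2 : (k : ℝ) ^ 2 * √(T : ℝ) * (6 + 4 * L) = k * u * (5 + 4 * L) + k * u := by
      rw [hu]; ring
    rw [Set.mem_ofPred_eq]
    linarith
  have htail : (Measure.pi fun _ => noise k u) Eᶜ ≤ ENNReal.ofReal (2 * ξ) := by
    refine (measure_mono hbad).trans ((h.measure_le_potential_le hku hu1 hl0 T _).trans
      (ENNReal.ofReal_le_ofReal ?_))
    refine (Real.exp_le_exp.2 (tail_exponent_le hk hT hL4 hu hl)).trans (le_of_eq ?_)
    rw [hLsq, Real.exp_sub, Real.exp_log (by norm_num), Real.exp_log (by positivity)]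
    field_simp
  rw [ENNReal.ofReal_sub _ (by linarith), ENNReal.ofReal_one, tsub_le_iff_right]
  calc (1 : ENNReal) = (Measure.pi fun _ : Fin T => noise k u) Set.univ := measure_univ.symm
    _ = (Measure.pi fun _ => noise k u) (E ∪ Eᶜ) := by rw [Set.union_compl_self]
    _ ≤ _ := (measure_union_le _ _).trans (add_le_add_right htail _)

theorem measurePreserving_perturbationLaw {T : ℕ} (hk : 0 < k) (hT : 0 < T) :
    MeasurePreserving (MeasurableEquiv.arrowProdEquivProdArrow (Vec k) (Vec k) (Fin T))
      (Measure.pi fun _ => noise k (k * √(T : ℝ))) (perturbationLaw k T) := by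
  have hu : 0 < k * √(T : ℝ) := by positivity
  have := isProbabilityMeasure_cubeMeasure (k := k) hu
  have hcube : uniformCube k (fplDelta k T) = cubeMeasure k (k * √(T : ℝ)) := by
    unfold uniformCube cubeMeasure cube fplDelta
    rw [one_div_one_div]
  unfold perturbationLaw
  rw [hcube]
  exact measurePreserving_arrowProdEquivProdArrow (Vec k) (Vec k) (Fin T)
    (fun _ => cubeMeasure k (k * √(T : ℝ))) fun _ => cubeMeasure k (k * √(T : ℝ))

theorem IsGame.nullMeasurableSet_forall_le_dotProduct (h : IsGame K P F G) {T : ℕ} (hk : 0 < k)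
    (hT : 0 < T) (b : ℝ) :
    NullMeasurableSet {pq : (Fin T → Vec k) × (Fin T → Vec k) | ∀ w ∈ P,
      b ≤ w ⬝ᵥ (fplState F G T fun t => (pq.1 t, pq.2 t)).2} (perturbationLaw k T) := by
  have hu : 0 < k * √(T : ℝ) := by positivity
  have hstate : AEMeasurable (fun pq : (Fin T → Vec k) × (Fin T → Vec k) =>
      fplState F G T fun t => (pq.1 t, pq.2 t)) (perturbationLaw k T) :=
    (aemeasurable_fplState hu h.aemeasurableF h.aemeasurableG T).comp_quasiMeasurePreserving
      ((measurePreserving_perturbationLaw hk hT).symm _).quasiMeasurePreserving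
  have hclosed : IsClosed {x : Vec k × Vec k | ∀ w ∈ P, b ≤ w ⬝ᵥ x.2} := by
    simp only [Set.ofPred_forall]
    exact isClosed_iInter fun w => isClosed_iInter fun _ =>
      isClosed_le continuous_const (by unfold dotProduct; fun_prop)
  exact hstate.nullMeasurableSet_preimage hclosed.measurableSet

end Guarantee

/-! ### The policies computed by the algorithm -/

section Run

variable {S A : Type*} [Fintype S] [Fintype A] {k : ℕ} {M : RewardlessMDP S A k}
  {alg : Vec k → Policy S A × Vec k}

theorem run_fplIteration {Pol : Type*} (alg : Vec k → Pol × Vec k) (so : Vec k → SepAnswer k)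
    (lp : Vec k → SepProg k) {n : ℕ} (h : Fin n → Round Pol k) (p q : Vec k) :
    (fplIteration lp h p q).run alg so =
      ⟨(alg (∑ i, (h i).weights + p)).1, (alg (∑ i, (h i).weights + p)).2,
        (lp (∑ i, (h i).features + q)).run so⟩ := by
  simp [fplIteration, Prog.run, Prog.run_bind, SepProg.run_toProg]

theorem sum_run_fplRounds {Pol : Type*} (alg : Vec k → Pol × Vec k) (so : Vec k → SepAnswer k)
    (lp : Vec k → SepProg k) (T : ℕ) (p q : Fin T → Vec k) :
    (∑ t, ((fplRounds lp T p q).run alg so t).weights,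
      ∑ t, ((fplRounds lp T p q).run alg so t).features) =
      fplState (fun v => (alg v).2) (fun v => (lp v).run so) T fun t => (p t, q t) := by
  induction T with
  | zero => simp [fplState]
  | succ T ih =>
    rw [fplState, ← ih]
    simp [fplRounds, Prog.run_bind, Prog.run, run_fplIteration, Fin.sum_univ_castSucc, fplStep]

theorem features_run_fplRounds (halg : IsMDPSolver M alg) (so : Vec k → SepAnswer k)
    (lp : Vec k → SepProg k) (T : ℕ) (p q : Fin T → Vec k) (t : Fin T) :
    ((fplRounds lp T p q).run alg so t).features =
      featureExp M ((fplRounds lp T p q).run alg so t).policy := by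
  induction T with
  | zero => exact t.elim0
  | succ T ih =>
    refine Fin.lastCases ?_ (fun t => ?_) t
    · simpa [fplRounds, Prog.run_bind, Prog.run, run_fplIteration] using (halg _).2
    · simpa [fplRounds, Prog.run_bind, Prog.run] using
        ih (fun t => p t.castSucc) (fun t => q t.castSucc) t

theorem uniformMixtureValue_fplPolicies (halg : IsMDPSolver M alg) (so : Vec k → SepAnswer k)
    (lp : Vec k → SepProg k) (T : ℕ) (p q : Fin T → Vec k) (w : Vec k) :
    uniformMixtureValue M (fplPolicies alg so lp T p q) w =
      1 / (T : ℝ) * (w ⬝ᵥ (fplState (fun v => (alg v).2) (fun v => (lp v).run so) T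
        fun t => (p t, q t)).2) := by
  rw [← sum_run_fplRounds]
  unfold uniformMixtureValue fplPolicies
  simp only [dotProduct_sum, features_run_fplRounds halg, value_eq]

theorem isGame_of_isMDPSolver (halg : IsMDPSolver M alg)
    (hnorm : ∀ π : Policy S A, ∑ j, |featureExp M π j| ≤ k) {PR : Set (Vec k)}
    (hbox : PR ⊆ Set.Icc (fun _ => -1) (fun _ => 1)) {so : Vec k → SepAnswer k}
    {lp : Vec k → SepProg k} (hlp : MinimizesOver PR so lp) :
    IsGame (featurePolytope M) PR (fun v => (alg v).2) (fun v => (lp v).run so) where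
  maxF :=
    { mem := fun v => ⟨_, (halg v).2.symm⟩
      le := by
        rintro v _ ⟨π, rfl⟩
        simp only [(halg v).2]
        simpa [value_eq, dotProduct_comm v] using (halg v).1 π }
  maxG :=
    { mem := fun v => by simpa using (hlp v).1
      le := fun v x hx => by
        have := (hlp v).2 (-x) hx
        rw [neg_dotProduct] at this ⊢
        linarith }
  sum_le := by
    rintro _ ⟨π, rfl⟩
    exact hnorm π
  abs_weight_le := fun w hw j => abs_le.2 ⟨(hbox hw).1 j, (hbox hw).2 j⟩

end Run

/-- A rational takes at least two bits, so the features alone make the bit bound at least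
`2 * k`. -/
theorem two_mul_add_le_bitBound {S A : Type*} [Fintype S] [Fintype A] {k β T b bφ : ℕ}
    (hk : 0 < k) (M : RewardlessMDP S A k) (hφ : ∀ s j, HasBits (M.feat s j) bφ) :
    2 * (k : ℝ) + β ≤
      ((b : ℝ) + bφ) * (Fintype.card A * Fintype.card S + k) + β + Real.log T := by
  have hS : Nonempty S := by
    by_contra hne
    rw [not_nonempty_iff] at hne
    have h1 : ∑ s, (M.init : S → ℝ) s = 1 := M.init.2.2
    simp at h1
  obtain ⟨s⟩ := hS
  have hbφ : (2 : ℝ) ≤ bφ := by exact_mod_cast (hφ s ⟨0, hk⟩).two_le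
  have hlog : 0 ≤ Real.log T := Real.log_natCast_nonneg T
  have hb : (0 : ℝ) ≤ b := Nat.cast_nonneg b
  have hk0 : (0 : ℝ) ≤ k := Nat.cast_nonneg k
  have hAS : (0 : ℝ) ≤ Fintype.card A * Fintype.card S := by positivity
  have : 2 * (k : ℝ) ≤ ((b : ℝ) + bφ) * (Fintype.card A * Fintype.card S + k) :=
    mul_le_mul (by linarith) (by linarith) hk0 (by linarith)
  linarith

end

end MaxminRL

theorem mainTheorem3 :
    -- the guarantee, for every exact implementation `lp` of the minimization step
    (∀ (S A : Type*) [Fintype S] [Fintype A] (k T : ℕ) (M : RewardlessMDP S A k)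
        (PR : Set (Vec k)) (alg : Vec k → Policy S A × Vec k) (so : Vec k → SepAnswer k)
        (lp : Vec k → SepProg k) (ξ : ℝ),
      0 < k → 0 < T → 0 < ξ → ξ < 1 / 2 →
      (∀ π : Policy S A, ∑ j, |featureExp M π j| ≤ k) →
      IsPolyhedron PR → PR.Nonempty → PR ⊆ Set.Icc (fun _ => -1) (fun _ => 1) →
      IsMDPSolver M alg → IsSeparationOracle PR so → MinimizesOver PR so lp →
      ∃ v : ℝ, IsMaxminValue (featurePolytope M) PR v ∧
        NullMeasurableSet {pq : (Fin T → Vec k) × (Fin T → Vec k) |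
          ∀ w ∈ PR, v - (k : ℝ) ^ 2 * (6 + 4 * √(Real.log (1 / ξ))) / √(T : ℝ) ≤
            uniformMixtureValue M (fplPolicies alg so lp T pq.1 pq.2) w} (perturbationLaw k T) ∧
        ENNReal.ofReal (1 - 2 * ξ) ≤ perturbationLaw k T {pq |
          ∀ w ∈ PR, v - (k : ℝ) ^ 2 * (6 + 4 * √(Real.log (1 / ξ))) / √(T : ℝ) ≤
            uniformMixtureValue M (fplPolicies alg so lp T pq.1 pq.2) w}) ∧
    -- an exact implementation `lp` with the claimed number of queries in every iteration
    (∃ C : ℝ, 0 < C ∧ ∀ k β : ℕ, 0 < k → ∃ lp : Vec k → SepProg k,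
      ∀ (PR : Set (Vec k)) (so : Vec k → SepAnswer k),
        DescribedWithBits PR β → PR.Nonempty → PR ⊆ Set.Icc (fun _ => -1) (fun _ => 1) →
        IsSeparationOracle PR so →
        MinimizesOver PR so lp ∧
        ∀ (S A : Type*) [Fintype S] [Fintype A] (M : RewardlessMDP S A k)
          (alg : Vec k → Policy S A × Vec k) (T b bφ : ℕ),
          0 < T → IsMDPSolver M alg →
          (∀ s a s', HasBits ((M.trans s a : S → ℝ) s') b) →
          (∀ s j, HasBits (M.feat s j) bφ) →
          ∀ (n : ℕ) (h : Fin n → Round (Policy S A) k) (p q : Vec k),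
            (fplIteration lp h p q).solverCalls alg so = 1 ∧
            ((fplIteration lp h p q).sepCalls alg so : ℝ) ≤
              C * ((k : ℝ) ^ 2 * (Real.log k ^ 2 +
                (((b : ℝ) + bφ) * (Fintype.card A * Fintype.card S + k) + β +
                  Real.log T) ^ 2))) := by
  refine ⟨?_, 3, by norm_num, ?_⟩
  · intro S A _ _ k T M PR alg so lp ξ hk hT hξ hξ2 hnorm hpoly hne hbox halg _ hlp
    have hgame := isGame_of_isMDPSolver halg hnorm hbox hlp
    obtain ⟨v, hv⟩ := exists_isMaxminValue (isCompact_featurePolytope M)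
      ⟨_, (alg 0).1, rfl⟩ (hpoly.isCompact hbox) hne
    obtain ⟨_, ⟨π, rfl⟩, hleast⟩ := hv.1
    have hT0 : (0 : ℝ) < T := by exact_mod_cast hT
    have hsq : √(T : ℝ) * √(T : ℝ) = T := Real.mul_self_sqrt hT0.le
    have hset : {pq : (Fin T → Vec k) × (Fin T → Vec k) |
        ∀ w ∈ PR, v - (k : ℝ) ^ 2 * (6 + 4 * √(Real.log (1 / ξ))) / √(T : ℝ) ≤
          uniformMixtureValue M (fplPolicies alg so lp T pq.1 pq.2) w} =
        {pq | ∀ w ∈ PR, T * v - k ^ 2 * √(T : ℝ) * (6 + 4 * √(Real.log (1 / ξ))) ≤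
          w ⬝ᵥ (fplState (fun v => (alg v).2) (fun v => (lp v).run so) T
            fun t => (pq.1 t, pq.2 t)).2} := by
      ext pq
      simp only [Set.mem_ofPred_eq, uniformMixtureValue_fplPolicies halg]
      refine forall₂_congr fun w _ => ?_
      rw [one_div (T : ℝ), le_inv_mul_iff₀ hT0, mul_sub]
      have : (T : ℝ) * (k ^ 2 * (6 + 4 * √(Real.log (1 / ξ))) / √(T : ℝ)) =
          k ^ 2 * √(T : ℝ) * (6 + 4 * √(Real.log (1 / ξ))) := by
        have hpos : 0 < √(T : ℝ) := Real.sqrt_pos.2 hT0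
        rw [mul_div_assoc', div_eq_iff hpos.ne']
        linear_combination (-(k ^ 2 * (6 + 4 * √(Real.log (1 / ξ))))) * hsq
      rw [this]
    refine ⟨v, hv, ?_, ?_⟩
    · rw [hset]
      exact hgame.nullMeasurableSet_forall_le_dotProduct hk hT _
    · rw [hset, ← (measurePreserving_perturbationLaw hk hT).measure_preimage_equiv]
      exact hgame.le_measure_forall_le_dotProduct hk hT ⟨π, rfl⟩ (featureExp_nonneg M π)
        (fun w hw => hleast.2 ⟨w, hw, rfl⟩) hξ hξ2
  · intro k β hk
    refine ⟨exactMinimizer k β, fun PR so hPR hne hbox hso =>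
      ⟨minimizesOver_exactMinimizer hk hPR hne hbox hso, ?_⟩⟩
    intro S A _ _ M alg T b bφ _ _ _ hφ n h p q
    refine ⟨solverCalls_fplIteration alg so _ h p q, ?_⟩
    exact (Nat.cast_le.2 (sepCalls_fplIteration_exactMinimizer_le alg so β h p q)).trans
      (cutRounds_le hk (two_mul_add_le_bitBound hk M hφ) _)
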